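/- Let $G=\mathrm{SL}_3(\mathbb R)$, $\Gamma=\mathrm{SL}_3(\mathbb Z)$, and let $g_t=\mathrm{diag}(e^t,e^t,e^{-2t})\in G$ ($t\in\mathbb R$) act on the space of left cosets $G/\Gamma$ (with the quotient topology) by left multiplication. For $K\subset G/\Gamma$ let $$D_K=\{x\in G/\Gamma:\ \text{there is } T\in\mathbb R \text{ such that } g_tx\notin K \text{ for all } t>T\}$$ be the set of points whose forward trajectory under $(g_t)$ eventually stays outside of $K$. Then there is a compact set $K\subset G/\Gamma$ such that the Hausdorff dimension of $D_K$ is strictly less than $8=\dim G/\Gamma$. Here the Hausdorff dimension is taken with respect to the metric $$d(x,y)=\inf\{d_G(g,h):\ g\Gamma=x,\ h\Gamma=y\},\qquad d_G(g,h)=\log\bigl(1+\max(\|gh^{-1}-I\|,\|hg^{-1}-I\|)\bigr),$$ where $\|\cdot\|$ is the maximal absolute row sum of a matrix. This metric induces the quotient topology and is locally bi-Lipschitz equivalent to any Riemannian metric on the manifold $G/\Gamma$, so that any Riemannian metric gives the same Hausdorff dimension. -/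

import Mathlib

open Filter Topology

open scoped MatrixGroups

noncomputable section

namespace SL3Flow

section Metric

-- Matrix norm used below: the operator norm on `ℝ³` with the sup norm (maximal absolute row sum).
attribute [local instance] Matrix.linftyOpNormedRing

/-- The group `G = SL₃(ℝ)`, with the topology induced from the space of matrices. -/
abbrev G : Type := Matrix.SpecialLinearGroup (Fin 3) ℝ

/-- The subgroup `Γ = SL₃(ℤ)` of `G`. -/
abbrev Γ : Subgroup G :=
  (Matrix.SpecialLinearGroup.map (n := Fin 3) (Int.castRingHom ℝ)).range

/-- The homogeneous space `SL₃(ℝ)/SL₃(ℤ)` of left cosets `gΓ`, with the quotient topology and the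
left action of `G`. -/
abbrev X : Type := G ⧸ Γ

/-- `log (1 + max (‖g - 1‖, ‖g⁻¹ - 1‖))`, a symmetric subadditive length function on `G`, which is
comparable to `‖g - 1‖` near the identity. -/
def len (g : G) : ℝ :=
  Real.log (1 + max ‖(g : Matrix (Fin 3) (Fin 3) ℝ) - 1‖
    ‖((g⁻¹ : G) : Matrix (Fin 3) (Fin 3) ℝ) - 1‖)

/-- The right-invariant distance on `G` given by `len`. Locally it is bi-Lipschitz equivalent to
the distance coming from a norm on matrices, hence to any Riemannian distance on the
`8`-dimensional manifold `G`. -/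
def distG (g h : G) : ℝ := len (g * h⁻¹)

/-- The quotient distance on `G/Γ`: the infimum of the distances between representatives. -/
def distX (x y : X) : ℝ :=
  sInf {r : ℝ | ∃ g h : G, (g : X) = x ∧ (h : X) = y ∧ r = distG g h}

lemma len_nonneg (g : G) : 0 ≤ len g := by
  refine Real.log_nonneg ?_
  have : 0 ≤ max ‖(g : Matrix (Fin 3) (Fin 3) ℝ) - 1‖
    ‖((g⁻¹ : G) : Matrix (Fin 3) (Fin 3) ℝ) - 1‖ := le_max_of_le_left (norm_nonneg _)
  linarith

lemma len_one : len 1 = 0 := by simp [len]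

lemma len_inv (g : G) : len g⁻¹ = len g := by
  unfold len; rw [inv_inv, max_comm]

lemma norm_mul_sub_one (A B : Matrix (Fin 3) (Fin 3) ℝ) :
    1 + ‖A * B - 1‖ ≤ (1 + ‖A - 1‖) * (1 + ‖B - 1‖) := by
  have h : A * B - 1 = (A - 1) * (B - 1) + (A - 1) + (B - 1) := by noncomm_ring
  have h1 := norm_add_le ((A - 1) * (B - 1) + (A - 1)) (B - 1)
  have h2 := norm_add_le ((A - 1) * (B - 1)) (A - 1)
  have h3 := norm_mul_le (A - 1) (B - 1)
  rw [h]; nlinarith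

lemma max_aux {a a' b b' c c' : ℝ} (ha : 0 ≤ a) (hb : 0 ≤ b) (hb' : 0 ≤ b')
    (h : 1 + c ≤ (1 + a) * (1 + b)) (h' : 1 + c' ≤ (1 + b') * (1 + a')) :
    1 + max c c' ≤ (1 + max a a') * (1 + max b b') := by
  have f1 : (1 + a) * (1 + b) ≤ (1 + max a a') * (1 + max b b') := by
    have := le_max_left a a'
    have := le_max_left b b'
    gcongr
  have f2 : (1 + b') * (1 + a') ≤ (1 + max a a') * (1 + max b b') := by
    have := le_max_right a a'
    have := le_max_right b b'
    rw [mul_comm]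
    gcongr
  rw [← max_add_add_left]
  exact max_le (h.trans f1) (h'.trans f2)

lemma len_mul (g h : G) : len (g * h) ≤ len g + len h := by
  have pos : ∀ k : G, 0 < 1 + max ‖(k : Matrix (Fin 3) (Fin 3) ℝ) - 1‖
      ‖((k⁻¹ : G) : Matrix (Fin 3) (Fin 3) ℝ) - 1‖ := fun k ↦ by
    have := le_max_of_le_left (b := ‖(k : Matrix (Fin 3) (Fin 3) ℝ) - 1‖)
      (c := ‖((k⁻¹ : G) : Matrix (Fin 3) (Fin 3) ℝ) - 1‖) (norm_nonneg _)
    linarith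
  unfold len
  rw [← Real.log_mul (pos g).ne' (pos h).ne']
  refine Real.log_le_log (pos _) (max_aux (norm_nonneg _) (norm_nonneg _) (norm_nonneg _) ?_ ?_)
  · rw [Matrix.SpecialLinearGroup.coe_mul]
    exact norm_mul_sub_one _ _
  · rw [mul_inv_rev, Matrix.SpecialLinearGroup.coe_mul]
    exact norm_mul_sub_one _ _

lemma norm_sub_one_le (g : G) :
    ‖(g : Matrix (Fin 3) (Fin 3) ℝ) - 1‖ ≤ Real.exp (len g) - 1 := by
  have h0 : 0 ≤ max ‖(g : Matrix (Fin 3) (Fin 3) ℝ) - 1‖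
    ‖((g⁻¹ : G) : Matrix (Fin 3) (Fin 3) ℝ) - 1‖ := le_max_of_le_left (norm_nonneg _)
  unfold len
  rw [Real.exp_log (by linarith)]
  have := le_max_left ‖(g : Matrix (Fin 3) (Fin 3) ℝ) - 1‖
    ‖((g⁻¹ : G) : Matrix (Fin 3) (Fin 3) ℝ) - 1‖
  linarith

lemma continuous_len : Continuous len := by
  unfold len
  have h1 : Continuous fun g : G ↦ (g : Matrix (Fin 3) (Fin 3) ℝ) := continuous_subtype_val
  have h2 : Continuous fun g : G ↦ ((g⁻¹ : G) : Matrix (Fin 3) (Fin 3) ℝ) :=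
    h1.comp continuous_inv
  refine Continuous.log (continuous_const.add
    ((h1.sub continuous_const).norm.max (h2.sub continuous_const).norm)) fun g ↦ ?_
  have h0 : 0 ≤ max ‖(g : Matrix (Fin 3) (Fin 3) ℝ) - 1‖
    ‖((g⁻¹ : G) : Matrix (Fin 3) (Fin 3) ℝ) - 1‖ := le_max_of_le_left (norm_nonneg _)
  linarith

lemma nhds_one_eq : 𝓝 (1 : G) = comap len (𝓝 0) := by
  apply le_antisymm
  · have := continuous_len.tendsto 1
    rw [len_one] at this
    exact this.le_comap
  · have e : 𝓝 (1 : G) = comap (fun g : G ↦ (g : Matrix (Fin 3) (Fin 3) ℝ))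
        (𝓝 (1 : Matrix (Fin 3) (Fin 3) ℝ)) :=
      Topology.IsInducing.nhds_eq_comap (Topology.IsInducing.subtypeVal) (1 : G)
    rw [e]
    rw [← tendsto_iff_comap]
    refine tendsto_iff_norm_sub_tendsto_zero.2 ?_
    have h : Tendsto (fun g : G ↦ Real.exp (len g) - 1) (comap len (𝓝 0)) (𝓝 0) := by
      have : Tendsto (fun r : ℝ ↦ Real.exp r - 1) (𝓝 0) (𝓝 (Real.exp 0 - 1)) :=
        (Real.continuous_exp.tendsto 0).sub_const 1
      rw [Real.exp_zero, sub_self] at this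
      exact this.comp tendsto_comap
    exact squeeze_zero (fun _ ↦ norm_nonneg _) norm_sub_one_le h

lemma distX_le (g h : G) : distX g h ≤ distG g h :=
  csInf_le ⟨0, by rintro _ ⟨_, _, _, _, rfl⟩; exact len_nonneg _⟩ ⟨g, h, rfl, rfl, rfl⟩

lemma distX_nonneg (x y : X) : 0 ≤ distX x y :=
  Real.sInf_nonneg (by rintro _ ⟨_, _, _, _, rfl⟩; exact len_nonneg _)

lemma distX_lt_iff (g : G) (y : X) (r : ℝ) :
    distX g y < r ↔ ∃ h : G, (h : X) = y ∧ distG g h < r := by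
  constructor
  · intro H
    obtain ⟨h₀, hh₀⟩ := QuotientGroup.mk_surjective y
    obtain ⟨_, ⟨g', h', hg, hh, rfl⟩, hr⟩ :=
      exists_lt_of_csInf_lt (⟨_, g, h₀, rfl, hh₀, rfl⟩ :
        {r : ℝ | ∃ g' h : G, (g' : X) = g ∧ (h : X) = y ∧ r = distG g' h}.Nonempty) H
    refine ⟨h' * (g'⁻¹ * g), ?_, ?_⟩
    · rw [QuotientGroup.mk_mul_of_mem _ (QuotientGroup.eq.mp hg), hh]
    · simpa [distG, mul_assoc] using hr
  · rintro ⟨h, rfl, H⟩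
    exact (distX_le g h).trans_lt H

lemma distX_self (x : X) : distX x x = 0 := by
  obtain ⟨g, rfl⟩ := QuotientGroup.mk_surjective x
  refine le_antisymm ((distX_le g g).trans ?_) (distX_nonneg _ _)
  simp [distG, len_one]

lemma distX_comm (x y : X) : distX x y = distX y x := by
  have h : ∀ g h : G, distG g h = distG h g := fun g h ↦ by
    unfold distG; rw [← len_inv, mul_inv_rev, inv_inv]
  unfold distX
  congr 1
  ext r
  constructor <;> rintro ⟨a, b, ha, hb, rfl⟩ <;> exact ⟨b, a, hb, ha, h _ _⟩

lemma distX_triangle (x y z : X) : distX x z ≤ distX x y + distX y z := by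
  obtain ⟨g, rfl⟩ := QuotientGroup.mk_surjective x
  refine le_of_forall_pos_lt_add fun ε hε ↦ ?_
  obtain ⟨h, rfl, hh⟩ := (distX_lt_iff g y (distX g y + ε / 2)).1 (by linarith)
  obtain ⟨k, rfl, hk⟩ := (distX_lt_iff h z (distX h z + ε / 2)).1 (by linarith)
  have h1 := distX_le g k
  have h2 : distG g k ≤ distG g h + distG h k := by
    have := len_mul (g * h⁻¹) (h * k⁻¹)
    simpa [distG, mul_assoc] using this
  linarith

/-- The quotient topology of `G/Γ` is the topology of `distX`. -/
lemma nhds_eq_comap_distX (x : X) : 𝓝 x = comap (distX x) (𝓝 0) := by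
  obtain ⟨g, rfl⟩ := QuotientGroup.mk_surjective x
  have hb : (𝓝 (0 : ℝ)).HasBasis (fun ε : ℝ ↦ 0 < ε) fun ε ↦ {r | |r| < ε} := by
    have := Metric.nhds_basis_ball (x := (0 : ℝ))
    rw [show Metric.ball (0 : ℝ) = fun ε : ℝ ↦ {r | |r| < ε} by funext ε; ext r; simp] at this
    exact this
  have h1 : (𝓝 g).HasBasis (fun ε : ℝ ↦ 0 < ε) fun ε ↦ {h | distG g h < ε} := by
    have e : 𝓝 g = comap (fun h : G ↦ g * h⁻¹) (𝓝 1) := by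
      have := ((Homeomorph.inv G).trans (Homeomorph.mulLeft g)).nhds_eq_comap g
      rw [this]
      simp only [Homeomorph.trans_apply, Homeomorph.coe_inv, Homeomorph.coe_mulLeft,
        mul_inv_cancel]
      rfl
    rw [e, nhds_one_eq, comap_comap]
    refine (hb.comap _).to_hasBasis (fun ε hε ↦ ⟨ε, hε, ?_⟩) (fun ε hε ↦ ⟨ε, hε, ?_⟩) <;>
    · intro h
      simp [distG, abs_of_nonneg (len_nonneg _)]
  have h2 := h1.map ((↑) : G → X)
  rw [← QuotientGroup.nhds_eq] at h2
  refine h2.eq_of_same_basis ((hb.comap (distX g)).to_hasBasis (fun ε hε ↦ ⟨ε, hε, ?_⟩)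
    (fun ε hε ↦ ⟨ε, hε, ?_⟩))
  · rintro _ ⟨h, hh, rfl⟩
    simpa [abs_of_nonneg (distX_nonneg _ _)] using (distX_le g h).trans_lt hh
  · intro y hy
    have hy' : distX g y < ε := by simpa [abs_of_nonneg (distX_nonneg _ _)] using hy
    obtain ⟨h, rfl, hh⟩ := (distX_lt_iff g y ε).1 hy'
    exact ⟨h, hh, rfl⟩

lemma isClosed_Γ : IsClosed (Γ : Set G) := by
  rw [MonoidHom.coe_range]
  exact Real.isClosedEmbedding_intCast.specialLinearGroup_map.isClosed_range

instance : T1Space X := by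
  refine ⟨fun x ↦ ?_⟩
  obtain ⟨g, rfl⟩ := QuotientGroup.mk_surjective x
  rw [← (QuotientGroup.isOpenQuotientMap_mk (N := Γ)).isQuotientMap.isClosed_preimage]
  have : ((↑) : G → X) ⁻¹' {(g : X)} = (fun h : G ↦ g⁻¹ * h) ⁻¹' (Γ : Set G) := by
    ext h
    simp only [Set.mem_preimage, Set.mem_singleton_iff, SetLike.mem_coe]
    rw [eq_comm, QuotientGroup.eq]
  rw [this]
  exact isClosed_Γ.preimage (continuous_const.mul continuous_id)

/-- `G/Γ` as a metric space with distance `distX`; its topology is the quotient topology. -/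
instance instMetricSpaceX : MetricSpace X :=
  letI P : PseudoMetricSpace X :=
    { dist := distX
      dist_self := distX_self
      dist_comm := distX_comm
      dist_triangle := distX_triangle }
  letI M : PseudoMetricSpace X := P.replaceTopology (by
    refine TopologicalSpace.ext_nhds fun x ↦ ?_
    rw [nhds_eq_comap_distX x, @nhds_comap_dist X P x |>.symm]
    congr 1
    funext y
    exact distX_comm x y)
  MetricSpace.ofT0PseudoMetricSpace X

end Metric

/-- The one-parameter subgroup `g_t = diag(e^t, e^t, e^{-2t})` of `SL₃(ℝ)`. -/
def g (t : ℝ) : G :=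
  ⟨Matrix.diagonal ![Real.exp t, Real.exp t, Real.exp (-2 * t)], by
    rw [Matrix.det_diagonal, Fin.prod_univ_three]
    simp only [Matrix.cons_val]
    rw [← Real.exp_add, ← Real.exp_add, Real.exp_eq_one_iff]
    ring⟩

/-- `D_K`: the points `x` of `G/Γ` whose forward trajectory `(g_t x)_{t ≥ 0}` eventually stays
outside of `K`. -/
def eventuallyOutside (K : Set X) : Set X :=
  {x | ∃ T : ℝ, ∀ t : ℝ, T < t → g t • x ∉ K}

end SL3Flow

end

/-! Identify the coset of `g` with the lattice `gℤ³`. By Mahler's criterion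
(`exists_isCompact_minLen_lt`) a compact `K` can be chosen so that every lattice outside it has a
very short vector. The proof counts how rarely a trajectory can have short vectors at all late
times.

The flow expands only the two-dimensional group `horo`, by the factor `exp (3 * t)`. One step takes
time `log m`, so each of the `N ^ 2` cells of a grid on the unit square, with `N = m ^ 3`, is blown
up to a full unit square. The tool is a Margulis height: `minLen ^ (-a)` of the lattice plus the
same for the dual lattice. For a fixed vector, most grid translates followed by one flow step
lengthen it, and the few bad ones cost little when `a` is small (`sum_stepMat_rpow_le`). This
controls the lattice unless it has two independent short vectors; then their cross product is an
even shorter vector of the dual lattice, and the dual term dominates (`sum_minLen_rpow_dichotomy`).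
Thus above a threshold the average height over the grid drops by a factor 2 in one step
(`exists_height_contraction`).

Iterating, the parameters `s` for which `horo s * h` keeps short vectors for `n` further steps are
covered by `O((N ^ 2 / 2) ^ n)` balls of radius about `N ^ (-n)` (`exists_isCoveredBy_shortAt`). The
complementary six directions, `parab`, are not expanded, so they change shortest vectors by at most
a factor 2 (`minLen_g_mul_le`) and are covered trivially. Altogether this bounds the dimension by `8
- log 2 / log N` (`hausdorffMeasure_chartAvoiding_ne_top`), and countably many charts and starting
times suffice. -/

namespace SL3Flow

attribute [local instance] Matrix.linftyOpNormedRing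

open Matrix

/-! ### Shortest vectors of unimodular lattices -/

/-- The real vector with the given integer coordinates. -/
def intVec (v : Fin 3 → ℤ) : Fin 3 → ℝ := fun i ↦ v i

lemma intVec_ne_zero {v : Fin 3 → ℤ} (hv : v ≠ 0) : intVec v ≠ 0 := by
  intro h
  apply hv
  funext i
  have := congrFun h i
  simpa [intVec] using this

lemma inv_mulVec_mulVec (g : G) (v : Fin 3 → ℝ) : (g⁻¹).1 *ᵥ (g.1 *ᵥ v) = v := by
  rw [mulVec_mulVec, ← Matrix.SpecialLinearGroup.coe_mul, inv_mul_cancel, Matrix.SpecialLinearGroup.coe_one,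
    one_mulVec]

lemma norm_le_norm_inv_mul (g : G) (v : Fin 3 → ℝ) : ‖v‖ ≤ ‖(g⁻¹).1‖ * ‖g.1 *ᵥ v‖ := by
  conv_lhs => rw [← inv_mulVec_mulVec g v]
  exact linfty_opNorm_mulVec _ _

lemma mulVec_ne_zero (g : G) {v : Fin 3 → ℝ} (hv : v ≠ 0) : g.1 *ᵥ v ≠ 0 := by
  intro h
  apply hv
  rw [← inv_mulVec_mulVec g v, h, mulVec_zero]

lemma finite_setOf_norm_mulVec_le (g : G) (r : ℝ) :
    {v : Fin 3 → ℤ | ‖g.1 *ᵥ intVec v‖ ≤ r}.Finite := by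
  set b : ℤ := ⌈‖(g⁻¹).1‖ * r⌉
  refine (Set.finite_Icc (fun _ ↦ -b : Fin 3 → ℤ) (fun _ ↦ b)).subset fun v hv ↦ ?_
  have h1 : ∀ i, |v i| ≤ b := fun i ↦ by
    have h2 : ‖intVec v i‖ ≤ ‖intVec v‖ := norm_le_pi_norm _ i
    have h3 := norm_le_norm_inv_mul g (intVec v)
    have h4 : ‖(g⁻¹).1‖ * ‖g.1 *ᵥ intVec v‖ ≤ ‖(g⁻¹).1‖ * r :=
      mul_le_mul_of_nonneg_left hv (norm_nonneg _)
    have h5 := Int.le_ceil (‖(g⁻¹).1‖ * r)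
    have h6 : |(v i : ℝ)| ≤ b := by
      rw [← Real.norm_eq_abs]
      exact h2.trans (h3.trans (h4.trans h5))
    exact_mod_cast h6
  exact ⟨fun i ↦ (abs_le.1 (h1 i)).1, fun i ↦ (abs_le.1 (h1 i)).2⟩

/-- The length of a shortest nonzero vector of the lattice `gℤ³`, for the sup norm. -/
noncomputable def minLen (g : G) : ℝ :=
  ⨅ v : {v : Fin 3 → ℤ // v ≠ 0}, ‖g.1 *ᵥ intVec v‖

lemma minLen_le (g : G) {v : Fin 3 → ℤ} (hv : v ≠ 0) : minLen g ≤ ‖g.1 *ᵥ intVec v‖ :=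
  ciInf_le (f := fun v : {v : Fin 3 → ℤ // v ≠ 0} ↦ ‖g.1 *ᵥ intVec v‖)
    ⟨0, by rintro _ ⟨_, rfl⟩; exact norm_nonneg _⟩ ⟨v, hv⟩

lemma exists_minLen_eq (g : G) : ∃ v : Fin 3 → ℤ, v ≠ 0 ∧ minLen g = ‖g.1 *ᵥ intVec v‖ := by
  have hone : (fun _ ↦ 1 : Fin 3 → ℤ) ≠ 0 := fun h ↦ by simpa using congrFun h 0
  set r := ‖g.1 *ᵥ intVec fun _ ↦ 1‖
  obtain ⟨v, ⟨hv, hvr⟩, hmin⟩ := Set.exists_min_image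
    {v : Fin 3 → ℤ | v ≠ 0 ∧ ‖g.1 *ᵥ intVec v‖ ≤ r} (fun v ↦ ‖g.1 *ᵥ intVec v‖)
    ((finite_setOf_norm_mulVec_le g r).subset fun v hv ↦ hv.2) ⟨fun _ ↦ 1, hone, le_rfl⟩
  refine ⟨v, hv, le_antisymm (minLen_le g hv) ?_⟩
  have : Nonempty {v : Fin 3 → ℤ // v ≠ 0} := ⟨⟨v, hv⟩⟩
  refine le_ciInf fun w ↦ ?_
  by_cases hw : ‖g.1 *ᵥ intVec w‖ ≤ r
  · exact hmin w ⟨w.2, hw⟩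
  · exact hvr.trans (not_le.1 hw).le

lemma minLen_pos (g : G) : 0 < minLen g := by
  obtain ⟨v, hv, h⟩ := exists_minLen_eq g
  rw [h]
  exact norm_pos_iff.2 (mulVec_ne_zero g (intVec_ne_zero hv))

lemma minLen_le_mul (g b : G) : minLen g ≤ ‖(b⁻¹).1‖ * minLen (b * g) := by
  obtain ⟨v, hv, h⟩ := exists_minLen_eq (b * g)
  rw [h, Matrix.SpecialLinearGroup.coe_mul, ← mulVec_mulVec]
  exact (minLen_le g hv).trans (norm_le_norm_inv_mul b _)

/-! ### Reduction of ternary quadratic forms and Mahler's criterion -/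

section Reduction

/-- Here `A`, `B`, `C` are the diagonal entries of a Gram matrix and `X`, `Y`, `Z` the off-diagonal
ones; the bracket on the right is its determinant. When `X * Y * Z ≥ 0` each subtracted term costs
at most a quarter of `A * B * C`; the other sign needs the extra bound `hneg`. -/
lemma gram_lower_bound_of_le {A B C X Y Z : ℝ} (hA : 0 ≤ A) (hAB : A ≤ B) (hBC : B ≤ C)
    (hX : 2 * |X| ≤ A) (hY : 2 * |Y| ≤ A) (hZ : 2 * |Z| ≤ B)
    (hneg : X * Y * Z < 0 → 2 * (|X| + |Y| + |Z|) ≤ A + B) :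
    A * B * C ≤ 4 * (A * B * C + 2 * (X * Y * Z) - A * Z ^ 2 - B * Y ^ 2 - C * X ^ 2) := by
  have hB : 0 ≤ B := hA.trans hAB
  have hC : 0 ≤ C := hB.trans hBC
  have habs : |X| * |Y| * |Z| = |X * Y * Z| := by rw [abs_mul, abs_mul]
  rw [← sq_abs X, ← sq_abs Y, ← sq_abs Z]
  obtain ⟨P, hP⟩ : ∃ P, P = |X| := ⟨_, rfl⟩
  obtain ⟨Q, hQ⟩ : ∃ Q, Q = |Y| := ⟨_, rfl⟩
  obtain ⟨S, hS⟩ : ∃ S, S = |Z| := ⟨_, rfl⟩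
  have hP0 : 0 ≤ P := hP ▸ abs_nonneg _
  have hQ0 : 0 ≤ Q := hQ ▸ abs_nonneg _
  have hS0 : 0 ≤ S := hS ▸ abs_nonneg _
  rw [← hP, ← hQ, ← hS] at habs hneg ⊢
  rw [← hP] at hX
  rw [← hQ] at hY
  rw [← hS] at hZ
  have hP2 : 4 * P ^ 2 ≤ A * A := by nlinarith
  have hQ2 : 4 * Q ^ 2 ≤ A * A := by nlinarith
  have hS2 : 4 * S ^ 2 ≤ B * B := by nlinarith
  have hAA : A * A ≤ A * B := mul_le_mul_of_nonneg_left hAB hA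
  have hAB0 : 0 ≤ A * B := mul_nonneg hA hB
  have e1 : A * (4 * S ^ 2) ≤ A * (B * C) :=
    mul_le_mul_of_nonneg_left (hS2.trans (mul_le_mul_of_nonneg_left hBC hB)) hA
  have e2 : B * (4 * Q ^ 2) ≤ A * B * C := by
    calc B * (4 * Q ^ 2) ≤ B * (A * B) := mul_le_mul_of_nonneg_left (hQ2.trans hAA) hB
      _ = A * B * B := by ring
      _ ≤ A * B * C := mul_le_mul_of_nonneg_left hBC hAB0
  have e3 : C * (4 * P ^ 2) ≤ C * (A * B) := mul_le_mul_of_nonneg_left (hP2.trans hAA) hC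
  have hABC : 0 ≤ A * B * C := mul_nonneg hAB0 hC
  rcases le_or_gt 0 (X * Y * Z) with h | h
  · linarith
  · have hlin := hneg h
    rw [abs_of_neg h] at habs
    -- This is the case `C = B` with a slightly better constant. Raising `C` from `B` helps, since
    -- `16 * P ^ 2 ≤ 4 * (A * B)`.
    suffices H : 16 * (2 * (P * Q * S) + A * S ^ 2 + B * Q ^ 2 + B * P ^ 2) ≤ 11 * (A * B * B) by
      have : 0 ≤ (C - B) * (11 * (A * B) - 16 * P ^ 2) :=
        mul_nonneg (by linarith) (by linarith)
      nlinarith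
    -- Either `P + Q` is well below its maximum `A`, or `hlin` forces `S` to be well below `B / 2`.
    rcases le_or_gt (4 * (P + Q)) (3 * A) with h1 | h1
    · have f1 : 16 * (P * Q + P ^ 2 + Q ^ 2) ≤ 7 * (A * A) := by
        have := mul_nonneg (sub_nonneg.2 hX) (sub_nonneg.2 hY)
        nlinarith
      have f2 : B * (16 * (P * Q + P ^ 2 + Q ^ 2)) ≤ B * (7 * (A * B)) :=
        mul_le_mul_of_nonneg_left (by linarith) hB
      have f3 : P * Q * (2 * S) ≤ P * Q * B :=
        mul_le_mul_of_nonneg_left hZ (mul_nonneg hP0 hQ0)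
      have f4 : A * (4 * S ^ 2) ≤ A * (B * B) := mul_le_mul_of_nonneg_left hS2 hA
      nlinarith
    · have hS' : 4 * S ≤ 2 * B - A := by linarith
      have f1 : 4 * (P * Q) ≤ A * A := by nlinarith
      have f2 : 4 * (P * Q) * S ≤ A * A * S := mul_le_mul_of_nonneg_right f1 hS0
      have f3 : B * (4 * (Q ^ 2 + P ^ 2)) ≤ B * (2 * (A * A)) :=
        mul_le_mul_of_nonneg_left (by linarith) hB
      have f4 : 16 * S ^ 2 ≤ (2 * B - A) ^ 2 := by nlinarith
      have f5 : A * (8 * (A * S) + 8 * (A * B) + 16 * S ^ 2) ≤ A * (11 * (B * B)) := by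
        refine mul_le_mul_of_nonneg_left ?_ hA
        have := mul_le_mul_of_nonneg_left hS' hA
        nlinarith [mul_nonneg (sub_nonneg.2 hAB) (by linarith : 0 ≤ 7 * B - A)]
      nlinarith

/-- The hypotheses say that adding integer multiples of two basis vectors to the third does not
shorten it. Single multiples bound `X`, `Y`, `Z`. If `X * Y * Z < 0`, signs `s, t = ±1` can be
chosen to make all three cross terms negative, which gives `hneg`. -/
lemma gram_lower_bound {A B C X Y Z : ℝ} (hA : 0 ≤ A) (hB : 0 ≤ B) (hC : 0 ≤ C)
    (h1 : ∀ s t : ℤ, 0 ≤ (s : ℝ) ^ 2 * B + t ^ 2 * C + 2 * s * X + 2 * t * Y + 2 * s * t * Z)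
    (h2 : ∀ s t : ℤ, 0 ≤ (s : ℝ) ^ 2 * A + t ^ 2 * C + 2 * s * X + 2 * t * Z + 2 * s * t * Y)
    (h3 : ∀ s t : ℤ, 0 ≤ (s : ℝ) ^ 2 * A + t ^ 2 * B + 2 * s * Y + 2 * t * Z + 2 * s * t * X) :
    A * B * C ≤ 4 * (A * B * C + 2 * (X * Y * Z) - A * Z ^ 2 - B * Y ^ 2 - C * X ^ 2) := by
  have key : ∀ {U : ℝ} (V : ℝ), 0 ≤ U + 2 * V → 0 ≤ U - 2 * V → 2 * |V| ≤ U := fun V h h' ↦ by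
    rcases abs_cases V with ⟨e, -⟩ | ⟨e, -⟩ <;> rw [e] <;> linarith
  have hXB : 2 * |X| ≤ B := by
    have a := h1 1 0; have b := h1 (-1) 0; push_cast at a b; exact key _ (by linarith) (by linarith)
  have hXA : 2 * |X| ≤ A := by
    have a := h2 1 0; have b := h2 (-1) 0; push_cast at a b; exact key _ (by linarith) (by linarith)
  have hYC : 2 * |Y| ≤ C := by
    have a := h1 0 1; have b := h1 0 (-1); push_cast at a b; exact key _ (by linarith) (by linarith)
  have hYA : 2 * |Y| ≤ A := by
    have a := h3 1 0; have b := h3 (-1) 0; push_cast at a b; exact key _ (by linarith) (by linarith)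
  have hZC : 2 * |Z| ≤ C := by
    have a := h2 0 1; have b := h2 0 (-1); push_cast at a b; exact key _ (by linarith) (by linarith)
  have hZB : 2 * |Z| ≤ B := by
    have a := h3 0 1; have b := h3 0 (-1); push_cast at a b; exact key _ (by linarith) (by linarith)
  have hneg : X * Y * Z < 0 → 2 * (|X| + |Y| + |Z|) ≤ B + C ∧ 2 * (|X| + |Y| + |Z|) ≤ A + C ∧
      2 * (|X| + |Y| + |Z|) ≤ A + B := by
    intro hn
    have a1 := h1 1 1; have a2 := h1 1 (-1); have a3 := h1 (-1) 1; have a4 := h1 (-1) (-1)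
    have b1 := h2 1 1; have b2 := h2 1 (-1); have b3 := h2 (-1) 1; have b4 := h2 (-1) (-1)
    have c1 := h3 1 1; have c2 := h3 1 (-1); have c3 := h3 (-1) 1; have c4 := h3 (-1) (-1)
    push_cast at a1 a2 a3 a4 b1 b2 b3 b4 c1 c2 c3 c4
    rcases le_total 0 X with hx | hx <;> rcases le_total 0 Y with hy | hy <;>
      rcases le_total 0 Z with hz | hz <;>
      simp only [abs_of_nonneg, abs_of_nonpos, hx, hy, hz] <;>
      first
        | (refine ⟨?_, ?_, ?_⟩ <;> linarith)
        | (exfalso; linarith [mul_nonneg (mul_nonneg hx hy) hz])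
        | (exfalso; linarith [mul_nonneg (mul_nonneg_of_nonpos_of_nonpos hx hy) hz])
        | (exfalso; linarith [mul_nonneg_of_nonpos_of_nonpos (mul_nonpos_of_nonneg_of_nonpos hx hy) hz])
        | (exfalso; linarith [mul_nonneg_of_nonpos_of_nonpos (mul_nonpos_of_nonpos_of_nonneg hx hy) hz])
  rcases le_total A B with hAB | hAB <;> rcases le_total B C with hBC | hBC <;>
    rcases le_total A C with hAC | hAC
  · have := gram_lower_bound_of_le hA hAB hBC hXA hYA hZB fun h ↦ (hneg h).2.2
    linarith
  · have := gram_lower_bound_of_le hA hAB hBC hXA hYA hZB fun h ↦ (hneg h).2.2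
    linarith
  · have := gram_lower_bound_of_le hA hAC hBC hYA hXA (Z := Z) hZC fun h ↦ by
      linarith [(hneg (by linarith)).2.1]
    linarith
  · have := gram_lower_bound_of_le hC hAC hAB hYC hZC (Z := X) hXA fun h ↦ by
      linarith [(hneg (by linarith)).2.1]
    linarith
  · have := gram_lower_bound_of_le hB hAB hAC hXB hZB (Z := Y) hYA fun h ↦ by
      linarith [(hneg (by linarith)).2.2]
    linarith
  · have := gram_lower_bound_of_le hB hBC hAC hZB hXB (Z := Y) hYC fun h ↦ by
      linarith [(hneg (by linarith)).1]
    linarith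
  · have := gram_lower_bound_of_le hC hBC hAB hZC hYC (Z := X) hXB fun h ↦ by
      linarith [(hneg (by linarith)).1]
    linarith
  · have := gram_lower_bound_of_le hC hBC hAB hZC hYC (Z := X) hXB fun h ↦ by
      linarith [(hneg (by linarith)).1]
    linarith

/-- The sum of the squares of the entries of a matrix. -/
def sumSq (M : Matrix (Fin 3) (Fin 3) ℝ) : ℝ := ∑ i, ∑ j, M i j ^ 2

/-- The inner product of two columns of a matrix. -/
def colInner (M : Matrix (Fin 3) (Fin 3) ℝ) (j k : Fin 3) : ℝ := ∑ i, M i j * M i k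

/-- The Gram determinant is `M.det ^ 2`, and the elementary integer matrices used here alter one
column by multiples of the other two. -/
lemma le_det_sq_of_minimal (M : Matrix (Fin 3) (Fin 3) ℝ)
    (h : ∀ E : SL(3, ℤ), sumSq M ≤ sumSq (M * (E.1.map (Int.castRingHom ℝ)))) :
    colInner M 0 0 * colInner M 1 1 * colInner M 2 2 ≤ 4 * M.det ^ 2 := by
  have hnn : ∀ j, 0 ≤ colInner M j j := fun j ↦ Finset.sum_nonneg fun i _ ↦ mul_self_nonneg _
  have := gram_lower_bound (hnn 0) (hnn 1) (hnn 2) (X := colInner M 0 1) (Y := colInner M 0 2)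
    (Z := colInner M 1 2) (fun s t ↦ ?_) (fun s t ↦ ?_) (fun s t ↦ ?_)
  · convert this using 2
    simp only [colInner, Fin.sum_univ_three, det_fin_three]
    ring
  · have := h ⟨!![1, 0, 0; s, 1, 0; t, 0, 1], by simp [det_fin_three]⟩
    simp [sumSq, colInner, Fin.sum_univ_three, mul_apply] at this ⊢
    linarith
  · have := h ⟨!![1, s, 0; 0, 1, 0; 0, t, 1], by simp [det_fin_three]⟩
    simp [sumSq, colInner, Fin.sum_univ_three, mul_apply] at this ⊢
    linarith
  · have := h ⟨!![1, 0, s; 0, 1, t; 0, 0, 1], by simp [det_fin_three]⟩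
    simp [sumSq, colInner, Fin.sum_univ_three, mul_apply] at this ⊢
    linarith

/-- The embedding of `SL₃(ℤ)` into `SL₃(ℝ)`. -/
abbrev ofInt : SL(3, ℤ) →* G := Matrix.SpecialLinearGroup.map (n := Fin 3) (Int.castRingHom ℝ)

lemma mul_ofInt_apply (g : G) (γ : SL(3, ℤ)) (i j : Fin 3) :
    (g * ofInt γ).1 i j = (g.1 *ᵥ intVec (fun k ↦ γ.1 k j)) i := by
  simp [mul_apply, mulVec, dotProduct, intVec, Fin.sum_univ_three]

/-- A bound on `sumSq` confines every column of `γ` to a finite set of integer vectors, so a minimum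
exists. -/
lemma exists_sumSq_minimal (g : G) :
    ∃ γ : SL(3, ℤ), ∀ E : SL(3, ℤ), sumSq (g * ofInt γ).1 ≤ sumSq (g * ofInt E).1 := by
  set r := sumSq (g * ofInt 1).1
  have hr : 0 ≤ r := Finset.sum_nonneg fun _ _ ↦ Finset.sum_nonneg fun _ _ ↦ sq_nonneg _
  have hfin : {γ : SL(3, ℤ) | sumSq (g * ofInt γ).1 ≤ r}.Finite := by
    have h1 := Set.Finite.pi' (fun _ : Fin 3 ↦ finite_setOf_norm_mulVec_le g (Real.sqrt r))
    refine Set.Finite.of_finite_image (f := fun γ : SL(3, ℤ) ↦ fun j k ↦ γ.1 k j)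
      (h1.subset ?_) ?_
    · rintro _ ⟨γ, hγ, rfl⟩ j
      refine (pi_norm_le_iff_of_nonneg (Real.sqrt_nonneg _)).2 fun i ↦ ?_
      rw [← mul_ofInt_apply, Real.norm_eq_abs]
      refine Real.abs_le_sqrt (le_trans ?_ hγ)
      calc (g * ofInt γ).1 i j ^ 2 ≤ ∑ j, (g * ofInt γ).1 i j ^ 2 :=
            Finset.single_le_sum (f := fun j ↦ (g * ofInt γ).1 i j ^ 2)
              (fun _ _ ↦ sq_nonneg _) (Finset.mem_univ j)
        _ ≤ _ := Finset.single_le_sum (f := fun i ↦ ∑ j, (g * ofInt γ).1 i j ^ 2)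
              (fun _ _ ↦ Finset.sum_nonneg fun _ _ ↦ sq_nonneg _) (Finset.mem_univ i)
    · intro γ _ γ' _ h
      ext i j
      exact congrFun (congrFun h j) i
  obtain ⟨γ, hγ, hmin⟩ := Set.exists_min_image _ (fun γ ↦ sumSq (g * ofInt γ).1) hfin
    ⟨1, show r ≤ r from le_rfl⟩
  refine ⟨γ, fun E ↦ ?_⟩
  by_cases hE : sumSq (g * ofInt E).1 ≤ r
  · exact hmin E hE
  · exact le_trans hγ (not_le.1 hE).le

/-- A lattice without short vectors has a basis with bounded entries. -/
lemma exists_entries_le (g : G) {ε : ℝ} (hε : 0 < ε) (h : ε ≤ minLen g) :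
    ∃ γ : SL(3, ℤ), ∀ i j, |(g * ofInt γ).1 i j| ≤ 2 / ε ^ 2 := by
  obtain ⟨γ, hγ⟩ := exists_sumSq_minimal g
  refine ⟨γ, ?_⟩
  set M := (g * ofInt γ).1 with hM
  have hdet := le_det_sq_of_minimal M fun E ↦ by
    have := hγ (γ * E)
    rw [map_mul, ← mul_assoc, Matrix.SpecialLinearGroup.coe_mul] at this
    exact this
  rw [(g * ofInt γ).2] at hdet
  have hcol : ∀ j, ε ^ 2 ≤ colInner M j j := fun j ↦ by
    have hne : (fun k ↦ γ.1 k j) ≠ 0 := fun h0 ↦ by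
      have := det_eq_zero_of_column_eq_zero (A := γ.1) j fun k ↦ congrFun h0 k
      rw [γ.2] at this
      exact one_ne_zero this
    have h1 : ε ≤ ‖g.1 *ᵥ intVec fun k ↦ γ.1 k j‖ := h.trans (minLen_le g hne)
    by_contra! hlt
    have h2 : ‖g.1 *ᵥ intVec fun k ↦ γ.1 k j‖ < ε := by
      refine (pi_norm_lt_iff hε).2 fun i ↦ ?_
      rw [← mul_ofInt_apply, Real.norm_eq_abs]
      refine abs_lt_of_sq_lt_sq (lt_of_le_of_lt ?_ hlt) hε.le
      rw [sq]
      exact Finset.single_le_sum (f := fun i ↦ M i j * M i j)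
        (fun _ _ ↦ mul_self_nonneg _) (Finset.mem_univ i)
    linarith
  have hε2 : 0 < ε ^ 2 := by positivity
  -- Three squared column lengths, each at least `ε ^ 2`, have product at most 4, so each is at most
  -- `4 / ε ^ 4`.
  have hbd : ∀ {a b c : ℝ}, ε ^ 2 ≤ a → ε ^ 2 ≤ b → ε ^ 2 ≤ c → a * b * c ≤ 4 →
      a ≤ (2 / ε ^ 2) ^ 2 := fun {a b c} ha hb hc habc ↦ by
    rw [div_pow, le_div_iff₀ (by positivity)]
    have h1 : ε ^ 2 * ε ^ 2 ≤ b * c := mul_le_mul hb hc hε2.le (hε2.le.trans hb)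
    have h2 := mul_le_mul_of_nonneg_left h1 (hε2.le.trans ha)
    nlinarith
  have hall : ∀ j, colInner M j j ≤ (2 / ε ^ 2) ^ 2 := by
    have h0 := hbd (hcol 0) (hcol 1) (hcol 2) (by linarith)
    have h1 := hbd (hcol 1) (hcol 0) (hcol 2) (by linarith)
    have h2 := hbd (hcol 2) (hcol 1) (hcol 0) (by linarith)
    rw [Fin.forall_fin_succ, Fin.forall_fin_two]
    exact ⟨h0, h1, h2⟩
  intro i j
  refine abs_le_of_sq_le_sq (le_trans ?_ (hall j)) (by positivity)
  rw [sq]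
  exact Finset.single_le_sum (f := fun i ↦ M i j * M i j)
    (fun _ _ ↦ mul_self_nonneg _) (Finset.mem_univ i)

/-- A compact subset of `G/Γ` whose complement consists of lattices with short vectors. -/
lemma exists_isCompact_minLen_lt {ε : ℝ} (hε : 0 < ε) :
    ∃ K : Set X, IsCompact K ∧ ∀ g : G, (g : X) ∉ K → minLen g < ε := by
  set S : Set G := {g | ∀ i j, |g.1 i j| ≤ 2 / ε ^ 2} with hS
  have hScpt : IsCompact S := by
    have hclosed : IsClosedEmbedding (Subtype.val : G → Matrix (Fin 3) (Fin 3) ℝ) := by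
      refine IsClosed.isClosedEmbedding_subtypeVal ?_
      exact isClosed_eq (Continuous.matrix_det continuous_id) continuous_const
    have hc : IsCompact (Set.univ.pi fun _ ↦ Set.univ.pi fun _ ↦
        Set.Icc (-(2 / ε ^ 2)) (2 / ε ^ 2) : Set (Fin 3 → Fin 3 → ℝ)) :=
      isCompact_univ_pi fun _ ↦ isCompact_univ_pi fun _ ↦ isCompact_Icc
    have := hclosed.isCompact_preimage (K := (Set.univ.pi fun _ ↦ Set.univ.pi fun _ ↦
        Set.Icc (-(2 / ε ^ 2)) (2 / ε ^ 2) : Set (Fin 3 → Fin 3 → ℝ))) hc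
    have e : S = (Subtype.val : G → Matrix (Fin 3) (Fin 3) ℝ) ⁻¹' (Set.univ.pi fun _ ↦
        Set.univ.pi fun _ ↦ Set.Icc (-(2 / ε ^ 2)) (2 / ε ^ 2) : Set (Fin 3 → Fin 3 → ℝ)) := by
      refine Set.ext fun g ↦ ⟨fun h i _ j _ ↦ abs_le.1 (h i j), fun h i j ↦ ?_⟩
      exact abs_le.2 (h i trivial j trivial)
    rw [e]
    exact this
  refine ⟨(fun g : G ↦ (g : X)) '' S, hScpt.image QuotientGroup.continuous_mk, fun g hg ↦ ?_⟩
  by_contra! hle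
  obtain ⟨γ, hγ⟩ := exists_entries_le g hε hle
  refine hg ⟨g * ofInt γ, hγ, ?_⟩
  exact QuotientGroup.mk_mul_of_mem g ⟨γ, rfl⟩

end Reduction

/-! ### The dual lattice and cross products -/

section Dual

/-- The inverse transpose; `dual g` maps `ℤ³` to the dual lattice of `gℤ³`. -/
def dual (g : G) : G := (g⁻¹).transpose

lemma dual_mul (g h : G) : dual (g * h) = dual g * dual h := by
  apply Subtype.ext
  rw [Matrix.SpecialLinearGroup.coe_mul]
  simp only [dual, _root_.mul_inv_rev, Matrix.SpecialLinearGroup.coe_transpose,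
    Matrix.SpecialLinearGroup.coe_mul, transpose_mul]

lemma dual_dual (g : G) : dual (dual g) = g := by
  have h1 : dual g * (g.transpose) = 1 := by
    apply Subtype.ext
    rw [Matrix.SpecialLinearGroup.coe_mul, Matrix.SpecialLinearGroup.coe_one]
    simp only [dual, Matrix.SpecialLinearGroup.coe_transpose]
    rw [← transpose_mul, ← Matrix.SpecialLinearGroup.coe_mul, mul_inv_cancel,
      Matrix.SpecialLinearGroup.coe_one, transpose_one]
  rw [dual, inv_eq_of_mul_eq_one_right h1]
  apply Subtype.ext
  simp only [Matrix.SpecialLinearGroup.coe_transpose, transpose_transpose]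

/-- The cofactor matrix acts on cross products, and it is the inverse transpose because the
determinant is 1. Hence cross products of lattice vectors lie in the dual lattice. -/
lemma dual_mulVec_cross (g : G) (v w : Fin 3 → ℝ) :
    (dual g).1 *ᵥ (v ⨯₃ w) = (g.1 *ᵥ v) ⨯₃ (g.1 *ᵥ w) := by
  simp only [dual, Matrix.SpecialLinearGroup.coe_transpose, Matrix.SpecialLinearGroup.coe_inv,
    adjugate_fin_three, cross_apply]
  ext i
  fin_cases i <;> simp [mulVec, dotProduct, Fin.sum_univ_three] <;> ring

lemma norm_cross_le (v w : Fin 3 → ℝ) : ‖v ⨯₃ w‖ ≤ 2 * ‖v‖ * ‖w‖ := by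
  have hb : ∀ i j k l, |v i * w j - v k * w l| ≤ 2 * ‖v‖ * ‖w‖ := fun i j k l ↦ by
    have h1 : |v i| * |w j| ≤ ‖v‖ * ‖w‖ :=
      mul_le_mul (norm_le_pi_norm v i) (norm_le_pi_norm w j) (abs_nonneg _) (norm_nonneg _)
    have h2 : |v k| * |w l| ≤ ‖v‖ * ‖w‖ :=
      mul_le_mul (norm_le_pi_norm v k) (norm_le_pi_norm w l) (abs_nonneg _) (norm_nonneg _)
    rw [← abs_mul] at h1 h2
    have := abs_sub (v i * w j) (v k * w l)
    linarith
  refine (pi_norm_le_iff_of_nonneg (by positivity)).2 fun i ↦ ?_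
  rw [cross_apply, Real.norm_eq_abs]
  fin_cases i
  · exact hb _ _ _ _
  · exact hb _ _ _ _
  · exact hb _ _ _ _

lemma intVec_cross (v w : Fin 3 → ℤ) : intVec (v ⨯₃ w) = intVec v ⨯₃ intVec w := by
  ext i
  rw [intVec, cross_apply, cross_apply]
  fin_cases i <;> simp [intVec]

lemma exists_eq_smul_of_cross_eq_zero {v w : Fin 3 → ℝ} (hv : v ≠ 0) (h : v ⨯₃ w = 0) :
    ∃ q : ℝ, w = q • v := by
  rw [cross_apply] at h
  have h0 : v 1 * w 2 - v 2 * w 1 = 0 := congrFun h 0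
  have h1 : v 2 * w 0 - v 0 * w 2 = 0 := congrFun h 1
  have h2 : v 0 * w 1 - v 1 * w 0 = 0 := congrFun h 2
  obtain ⟨i, hi⟩ := Function.ne_iff.1 hv
  simp only [Pi.zero_apply] at hi
  refine ⟨w i / v i, funext fun j ↦ ?_⟩
  rw [Pi.smul_apply, smul_eq_mul, div_mul_eq_mul_div, eq_div_iff hi]
  fin_cases i <;> fin_cases j <;> simp <;> linarith

end Dual

/-! ### Averaging the height function -/

section Contraction

variable {ι : Type*} [Fintype ι]

/-- If all nearly shortest vectors are parallel to one shortest vector, that vector stays shortest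
under every `B c` and `hS` applies to it. Otherwise two independent short vectors have a cross
product in the dual lattice of length `O(minLen g ^ 2)`. The second alternative bounds a square, so
its terms are only of the order of the square root of the dual height. -/
lemma sum_minLen_rpow_dichotomy {B : ι → G} {R : ℝ} (hR : ∀ c, ‖(B c).1‖ ≤ R)
    (hR' : ∀ c, ‖((B c)⁻¹).1‖ ≤ R) {a S : ℝ} (ha : 0 ≤ a)
    (hS : ∀ v : Fin 3 → ℝ, v ≠ 0 → ∑ c, ‖(B c).1 *ᵥ v‖ ^ (-a) ≤ S * ‖v‖ ^ (-a)) (g : G) :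
    ∑ c, minLen (B c * g) ^ (-a) ≤ S * minLen g ^ (-a) ∨
      ∀ c, (minLen (B c * g) ^ (-a)) ^ 2 ≤ (2 * R ^ 4) ^ a * minLen (dual g) ^ (-a) := by
  rcases isEmpty_or_nonempty ι with hι | ⟨⟨c₀⟩⟩
  · exact Or.inr fun c ↦ (hι.false c).elim
  have hR0 : 0 ≤ R := (norm_nonneg _).trans (hR c₀)
  obtain ⟨v, hv, hvlen⟩ := exists_minLen_eq g
  -- A shortest vector of `B c * g` has length at most `R * minLen g`; pulling it back by `B c`
  -- costs another factor `R`.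
  by_cases H : ∀ w : Fin 3 → ℤ, ‖g.1 *ᵥ intVec w‖ ≤ R ^ 2 * minLen g → v ⨯₃ w = 0
  · left
    rw [hvlen]
    refine le_trans (Finset.sum_le_sum fun c _ ↦ ?_)
      (hS _ (mulVec_ne_zero g (intVec_ne_zero hv)))
    obtain ⟨w, hw, hwlen⟩ := exists_minLen_eq (B c * g)
    refine Real.rpow_le_rpow_of_nonpos
      (norm_pos_iff.2 (mulVec_ne_zero _ (mulVec_ne_zero g (intVec_ne_zero hv)))) ?_
      (neg_nonpos.2 ha)
    have h1 := minLen_le (B c * g) hv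
    rw [hwlen, Matrix.SpecialLinearGroup.coe_mul, ← mulVec_mulVec, ← mulVec_mulVec] at h1
    have h2 : ‖g.1 *ᵥ intVec w‖ ≤ R ^ 2 * minLen g := by
      have e1 := norm_le_norm_inv_mul (B c) (g.1 *ᵥ intVec w)
      have e2 := linfty_opNorm_mulVec (B c).1 (g.1 *ᵥ intVec v)
      rw [← hvlen] at e2
      have hm := (minLen_pos g).le
      calc ‖g.1 *ᵥ intVec w‖ ≤ R * ‖(B c).1 *ᵥ g.1 *ᵥ intVec w‖ :=
            e1.trans (mul_le_mul_of_nonneg_right (hR' c) (norm_nonneg _))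
        _ ≤ R * (R * minLen g) := mul_le_mul_of_nonneg_left
            (h1.trans (e2.trans (mul_le_mul_of_nonneg_right (hR c) hm))) hR0
        _ = R ^ 2 * minLen g := by ring
    have h3 := H w h2
    have h4 : intVec v ⨯₃ intVec w = 0 := by
      rw [← intVec_cross, h3]; ext; simp [intVec]
    obtain ⟨q, hq⟩ := exists_eq_smul_of_cross_eq_zero (intVec_ne_zero hv) h4
    rw [hwlen, Matrix.SpecialLinearGroup.coe_mul, ← mulVec_mulVec, hq, mulVec_smul, mulVec_smul,
      norm_smul]
    have h5 := minLen_le g hw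
    rw [hq, mulVec_smul, norm_smul, ← hvlen] at h5
    have h6 : 1 ≤ ‖q‖ := by
      by_contra! hlt
      have := mul_lt_mul_of_pos_right hlt (minLen_pos g)
      linarith
    exact le_mul_of_one_le_left (norm_nonneg _) h6
  · right
    push Not at H
    obtain ⟨w, hw, hvw⟩ := H
    intro c
    have h1 : minLen (dual g) ≤ 2 * R ^ 2 * minLen g ^ 2 := by
      have := minLen_le (dual g) hvw
      rw [intVec_cross, dual_mulVec_cross] at this
      refine this.trans ((norm_cross_le _ _).trans ?_)
      rw [← hvlen]
      have hm := (minLen_pos g).le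
      calc 2 * minLen g * ‖g.1 *ᵥ intVec w‖ ≤ 2 * minLen g * (R ^ 2 * minLen g) :=
            mul_le_mul_of_nonneg_left hw (by positivity)
        _ = _ := by ring
    have h2 : minLen g ≤ R * minLen (B c * g) := (minLen_le_mul g (B c)).trans
      (mul_le_mul_of_nonneg_right (hR' c) (minLen_pos _).le)
    have hp := minLen_pos (B c * g)
    have hd := minLen_pos (dual g)
    have h3 : minLen (dual g) ≤ (2 * R ^ 4) * minLen (B c * g) ^ 2 := by
      have : minLen g ^ 2 ≤ (R * minLen (B c * g)) ^ 2 :=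
        pow_le_pow_left₀ (minLen_pos g).le h2 2
      calc _ ≤ _ := h1
        _ ≤ 2 * R ^ 2 * (R * minLen (B c * g)) ^ 2 :=
            mul_le_mul_of_nonneg_left this (by positivity)
        _ = _ := by ring
    have h4 := Real.rpow_le_rpow hd.le h3 ha
    rw [Real.mul_rpow (by positivity) (by positivity), ← Real.rpow_pow_comm hp.le] at h4
    rw [Real.rpow_neg hp.le, Real.rpow_neg hd.le, inv_pow, ← div_eq_mul_inv, inv_eq_one_div,
      div_le_div_iff₀ (by positivity) (by positivity), one_mul]
    exact h4

/-- The height function on `G` built from the shortest vectors of a lattice and of its dual. -/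
noncomputable def height (a : ℝ) (g : G) : ℝ := minLen g ^ (-a) + minLen (dual g) ^ (-a)

lemma height_pos (a : ℝ) (g : G) : 0 < height a g :=
  add_pos (Real.rpow_pos_of_pos (minLen_pos _) _) (Real.rpow_pos_of_pos (minLen_pos _) _)

/-- Each of the two terms contracts by a factor 4, up to an error of `height a g / 8` per index from
the second alternative of the dichotomy. The sum is `1 / 4 + 2 / 8 = 1 / 2`. -/
lemma sum_height_le {B : ι → G} {R : ℝ} (hR : ∀ c, ‖(B c).1‖ ≤ R)
    (hR' : ∀ c, ‖((B c)⁻¹).1‖ ≤ R) (hRd : ∀ c, ‖(dual (B c)).1‖ ≤ R)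
    (hRd' : ∀ c, ‖((dual (B c))⁻¹).1‖ ≤ R) {a : ℝ} (ha : 0 ≤ a)
    (hS : ∀ v : Fin 3 → ℝ, v ≠ 0 →
      ∑ c, ‖(B c).1 *ᵥ v‖ ^ (-a) ≤ Fintype.card ι / 4 * ‖v‖ ^ (-a))
    (hSd : ∀ v : Fin 3 → ℝ, v ≠ 0 →
      ∑ c, ‖(dual (B c)).1 *ᵥ v‖ ^ (-a) ≤ Fintype.card ι / 4 * ‖v‖ ^ (-a)) :
    ∃ M : ℝ, 1 ≤ M ∧ ∀ g : G, M ≤ height a g →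
      ∑ c, height a (B c * g) ≤ Fintype.card ι / 2 * height a g := by
  set D := (2 * R ^ 4) ^ a with hD
  have hD0 : 0 ≤ D := Real.rpow_nonneg (by positivity) _
  -- Above `64 * D`, a square at most `D * height` is at most `(height / 8) ^ 2`.
  refine ⟨max 1 (64 * D), le_max_left _ _, fun g hg ↦ ?_⟩
  have h1 : 1 ≤ height a g := (le_max_left _ _).trans hg
  have h2 : 64 * D ≤ height a g := (le_max_right _ _).trans hg
  have hx : 0 < minLen g ^ (-a) := Real.rpow_pos_of_pos (minLen_pos _) _
  have hy : 0 < minLen (dual g) ^ (-a) := Real.rpow_pos_of_pos (minLen_pos _) _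
  have hcard : (0 : ℝ) ≤ Fintype.card ι := Nat.cast_nonneg _
  have small : ∀ {f : ι → ℝ} {y : ℝ}, y ≤ height a g → (∀ c, f c ^ 2 ≤ D * y) →
      ∑ c, f c ≤ Fintype.card ι * (height a g / 8) := fun {f y} hy h ↦ by
    have : ∀ c ∈ Finset.univ, f c ≤ height a g / 8 := fun c _ ↦ by
      refine le_of_sq_le_sq ?_ (by linarith)
      have h3 := mul_le_mul_of_nonneg_left hy hD0
      have h4 := mul_le_mul_of_nonneg_right h2 (height_pos a g).le
      have := h c
      nlinarith
    simpa using Finset.sum_le_card_nsmul _ _ _ this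
  have A1 : ∑ c, minLen (B c * g) ^ (-a) ≤
      Fintype.card ι / 4 * minLen g ^ (-a) + Fintype.card ι * (height a g / 8) := by
    rcases sum_minLen_rpow_dichotomy hR hR' ha hS g with h | h
    · have := height_pos a g
      have : 0 ≤ (Fintype.card ι : ℝ) * (height a g / 8) := by positivity
      linarith
    · have := small (y := minLen (dual g) ^ (-a)) (by unfold height; linarith) h
      have : 0 ≤ (Fintype.card ι : ℝ) / 4 * minLen g ^ (-a) := by positivity
      linarith
  have A2 : ∑ c, minLen (dual (B c * g)) ^ (-a) ≤
      Fintype.card ι / 4 * minLen (dual g) ^ (-a) + Fintype.card ι * (height a g / 8) := by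
    simp only [dual_mul]
    rcases sum_minLen_rpow_dichotomy hRd hRd' ha hSd (dual g) with h | h
    · have := height_pos a g
      have : 0 ≤ (Fintype.card ι : ℝ) * (height a g / 8) := by positivity
      linarith
    · rw [dual_dual] at h
      have := small (y := minLen g ^ (-a)) (by unfold height; linarith) h
      have : 0 ≤ (Fintype.card ι : ℝ) / 4 * minLen (dual g) ^ (-a) := by positivity
      linarith
  calc ∑ c, height a (B c * g) = ∑ c, minLen (B c * g) ^ (-a) +
        ∑ c, minLen (dual (B c * g)) ^ (-a) := Finset.sum_add_distrib
    _ ≤ _ := add_le_add A1 A2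
    _ = _ := by unfold height; ring

end Contraction

/-! ### Counting and summing over grid points -/

section Grid

/-- The midpoint of the `i`-th of `N` intervals of equal length subdividing `[-1, 1]`. -/
noncomputable def midpt (N : ℕ) (i : Fin N) : ℝ := (2 * (i : ℝ) + 1 - N) / N

lemma abs_midpt_le (N : ℕ) (i : Fin N) : |midpt N i| ≤ 1 := by
  have hi : (i : ℝ) + 1 ≤ N := by exact_mod_cast i.2
  have hi0 : (0 : ℝ) ≤ i := Nat.cast_nonneg _
  have hN : (0 : ℝ) < N := by linarith
  rw [midpt, abs_div, abs_of_pos hN, div_le_one hN, abs_le]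
  constructor <;> linarith

lemma exists_abs_sub_midpt_le {N : ℕ} (hN : 0 < N) {x : ℝ} (hx : |x| ≤ 1) :
    ∃ i, |x - midpt N i| ≤ 1 / N := by
  have hN' : (0 : ℝ) < N := by exact_mod_cast hN
  obtain ⟨hx1, hx2⟩ := abs_le.1 hx
  have key : ∀ i : Fin N, (i : ℝ) ≤ N * (x + 1) / 2 → N * (x + 1) / 2 ≤ i + 1 →
      |x - midpt N i| ≤ 1 / N := fun i h1 h2 ↦ by
    have e : x - midpt N i = (N * (x + 1) - 2 * i - 1) / N := by
      rw [midpt]; field_simp; ring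
    rw [e, abs_div, abs_of_pos hN']
    refine div_le_div_of_nonneg_right ?_ hN'.le
    rw [abs_le]
    constructor <;> linarith
  have hy0 : 0 ≤ N * (x + 1) / 2 := by
    have : 0 ≤ x + 1 := by linarith
    positivity
  rcases lt_or_ge ⌊N * (x + 1) / 2⌋₊ N with h | h
  · exact ⟨⟨_, h⟩, key ⟨_, h⟩ (Nat.floor_le hy0) (Nat.lt_floor_add_one _).le⟩
  · refine ⟨⟨N - 1, by omega⟩, key _ ?_ ?_⟩
    · have h1 : (N : ℝ) ≤ N * (x + 1) / 2 := (Nat.le_floor_iff hy0).1 h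
      simp only [Nat.cast_sub (Nat.one_le_iff_ne_zero.2 hN.ne'), Nat.cast_one]
      linarith
    · simp only [Nat.cast_sub (Nat.one_le_iff_ne_zero.2 hN.ne'), Nat.cast_one]
      have := mul_le_mul_of_nonneg_left hx2 hN'.le
      linarith

lemma card_abs_midpt_sub_lt {N : ℕ} (hN : 0 < N) (β : ℝ) {ρ : ℝ} (hρ : 0 ≤ ρ) :
    ((Finset.univ.filter fun i : Fin N ↦ |midpt N i - β| < ρ).card : ℝ) ≤ N * ρ + 1 := by
  have hN' : (0 : ℝ) < N := by exact_mod_cast hN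
  set x : ℝ := (N * β - 1 + N) / 2 with hx
  have hsub : (Finset.univ.filter fun i : Fin N ↦ |midpt N i - β| < ρ).card ≤
      (Finset.Icc ⌈x - N * ρ / 2⌉ ⌊x + N * ρ / 2⌋).card := by
    refine Finset.card_le_card_of_injOn (fun i ↦ ((i : ℕ) : ℤ)) (fun i hi ↦ ?_) ?_
    · simp only [Finset.coe_filter, Finset.mem_univ, true_and, Set.mem_ofPred_eq] at hi
      have e : midpt N i - β = 2 * (i - x) / N := by
        rw [midpt, hx]; field_simp; ring
      rw [e, abs_div, abs_of_pos hN', div_lt_iff₀ hN', abs_lt] at hi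
      simp only [Finset.coe_Icc, Set.mem_Icc, Int.ceil_le, Int.le_floor, Int.cast_natCast]
      constructor <;> linarith
    · intro i _ j _ hij
      exact Fin.ext (by simpa using hij)
  rw [Int.card_Icc] at hsub
  have h1 : ((⌊x + N * ρ / 2⌋ + 1 - ⌈x - N * ρ / 2⌉ : ℤ) : ℝ) ≤ N * ρ + 1 := by
    push_cast
    linarith [Int.floor_le (x + N * ρ / 2), Int.le_ceil (x - N * ρ / 2)]
  refine le_trans (b := ((⌊x + N * ρ / 2⌋ + 1 - ⌈x - N * ρ / 2⌉).toNat : ℝ))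
    (by exact_mod_cast hsub) ?_
  rcases le_total 0 (⌊x + N * ρ / 2⌋ + 1 - ⌈x - N * ρ / 2⌉) with h | h
  · have h2 : (((⌊x + N * ρ / 2⌋ + 1 - ⌈x - N * ρ / 2⌉).toNat : ℤ) : ℝ) ≤ N * ρ + 1 := by
      rw [Int.toNat_of_nonneg h]; exact h1
    exact_mod_cast h2
  · rw [Int.toNat_of_nonpos h]
    have : 0 ≤ N * ρ := by positivity
    push_cast
    linarith

/-- In each row the strip of width `ρ` around `β j` has at most `N * ρ + 1` points, where only the
worst bound `X` holds; everywhere else the good bound `Y` holds. -/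
lemma sum_sum_rpow_le {N : ℕ} (hN : 0 < N) {F : Fin N → Fin N → ℝ} {a ρ X Y : ℝ} (ha : 0 ≤ a)
    (hρ : 0 ≤ ρ) (hX : 0 < X) (hY : 0 < Y) (β : Fin N → ℝ) (hFX : ∀ i j, X ≤ F i j)
    (hFY : ∀ i j, ρ ≤ |midpt N i - β j| → Y ≤ F i j) :
    ∑ j, ∑ i, F i j ^ (-a) ≤ N * ((N * ρ + 1) * X ^ (-a)) + N * (N * Y ^ (-a)) := by
  have hX' : 0 ≤ X ^ (-a) := Real.rpow_nonneg hX.le _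
  have hY' : 0 ≤ Y ^ (-a) := Real.rpow_nonneg hY.le _
  have h1 : ∀ i j, F i j ^ (-a) ≤
      (if |midpt N i - β j| < ρ then X ^ (-a) else 0) + Y ^ (-a) := fun i j ↦ by
    split_ifs with h
    · have := Real.rpow_le_rpow_of_nonpos hX (hFX i j) (neg_nonpos.2 ha)
      linarith
    · have := Real.rpow_le_rpow_of_nonpos hY (hFY i j (not_lt.1 h)) (neg_nonpos.2 ha)
      linarith
  have h2 : ∀ j ∈ Finset.univ, ∑ i, F i j ^ (-a) ≤
      (N * ρ + 1) * X ^ (-a) + N * Y ^ (-a) := fun j _ ↦ by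
    refine (Finset.sum_le_sum fun i _ ↦ h1 i j).trans ?_
    rw [Finset.sum_add_distrib, ← Finset.sum_filter, Finset.sum_const, Finset.sum_const,
      nsmul_eq_mul, nsmul_eq_mul, Finset.card_univ, Fintype.card_fin]
    have := mul_le_mul_of_nonneg_right (card_abs_midpt_sub_lt hN (β j) hρ) hX'
    linarith
  refine (Finset.sum_le_card_nsmul _ _ _ h2).trans (le_of_eq ?_)
  rw [Finset.card_univ, Fintype.card_fin, nsmul_eq_mul]
  ring

end Grid

/-! ### The horospherical group and expansion of vectors by one step -/

section Matrices

/-- The elements of the expanding horospherical subgroup of `(g t)`. -/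
def horo (s : ℝ × ℝ) : G :=
  ⟨!![1, 0, s.1; 0, 1, s.2; 0, 0, 1], by simp [det_fin_three]⟩

lemma horo_add (s t : ℝ × ℝ) : horo (s + t) = horo s * horo t := by
  apply Subtype.ext
  rw [Matrix.SpecialLinearGroup.coe_mul]
  ext i j
  fin_cases i <;> fin_cases j <;> simp [horo, mul_apply, Fin.sum_univ_three, add_comm]

lemma horo_zero : horo 0 = 1 := by
  apply Subtype.ext
  ext i j
  fin_cases i <;> fin_cases j <;> simp [horo]

lemma horo_neg (s : ℝ × ℝ) : horo (-s) = (horo s)⁻¹ := by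
  rw [eq_inv_iff_mul_eq_one, ← horo_add, neg_add_cancel, horo_zero]

lemma g_mul_horo (t : ℝ) (s : ℝ × ℝ) : g t * horo s = horo (Real.exp (3 * t) • s) * g t := by
  apply Subtype.ext
  rw [Matrix.SpecialLinearGroup.coe_mul, Matrix.SpecialLinearGroup.coe_mul]
  have h : Real.exp t = Real.exp (3 * t) * Real.exp (-(2 * t)) := by
    rw [← Real.exp_add]; congr 1; ring
  ext i j
  fin_cases i <;> fin_cases j <;>
    simp [horo, g, mul_apply, diagonal]
  · linear_combination s.1 * h
  · linear_combination s.2 * h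

lemma g_add (s t : ℝ) : g (s + t) = g s * g t := by
  apply Subtype.ext
  rw [Matrix.SpecialLinearGroup.coe_mul]
  simp only [g, diagonal_mul_diagonal]
  congr 1
  ext i
  fin_cases i <;> simp [← Real.exp_add]
  ring

lemma norm_le_of_entries {M : Matrix (Fin 3) (Fin 3) ℝ} {r : ℝ} (hr : 0 ≤ r)
    (h : ∀ i, |M i 0| + |M i 1| + |M i 2| ≤ r) : ‖M‖ ≤ r := by
  lift r to NNReal using hr
  rw [linfty_opNorm_def, NNReal.coe_le_coe, Finset.sup_le_iff]
  intro i _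
  rw [← NNReal.coe_le_coe, Fin.sum_univ_three]
  simpa using h i

lemma norm_horo_le {s : ℝ × ℝ} (h1 : |s.1| ≤ 1) (h2 : |s.2| ≤ 1) : ‖(horo s).1‖ ≤ 2 := by
  refine norm_le_of_entries (by norm_num) fun i ↦ ?_
  fin_cases i <;> simp [horo] <;> linarith

/-- The product of `g (log m)` and the element of `horo` at a point of the grid. -/
noncomputable def stepMat (m N : ℕ) (c : Fin N × Fin N) : G :=
  g (Real.log m) * horo (midpt N c.1, midpt N c.2)

lemma g_log_coe {m : ℕ} (hm : 0 < m) :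
    (g (Real.log m)).1 = diagonal ![(m : ℝ), m, ((m : ℝ) ^ 2)⁻¹] := by
  have hm' : (0 : ℝ) < m := by exact_mod_cast hm
  have : Real.exp (-2 * Real.log m) = ((m : ℝ) ^ 2)⁻¹ := by
    rw [show -2 * Real.log m = -(Real.log m + Real.log m) by ring, Real.exp_neg, Real.exp_add,
      Real.exp_log hm', sq]
  simp only [g, Real.exp_log hm', this]

lemma stepMat_mulVec {m : ℕ} (hm : 0 < m) {N : ℕ} (c : Fin N × Fin N) (v : Fin 3 → ℝ) :
    (stepMat m N c).1 *ᵥ v = ![m * (v 0 + midpt N c.1 * v 2), m * (v 1 + midpt N c.2 * v 2),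
      ((m : ℝ) ^ 2)⁻¹ * v 2] := by
  rw [stepMat, Matrix.SpecialLinearGroup.coe_mul, ← mulVec_mulVec, g_log_coe hm]
  ext i
  fin_cases i <;> simp [horo, mulVec, dotProduct, Fin.sum_univ_three, diagonal]

lemma dual_stepMat_mulVec {m : ℕ} (hm : 0 < m) {N : ℕ} (c : Fin N × Fin N) (v : Fin 3 → ℝ) :
    (dual (stepMat m N c)).1 *ᵥ v = ![(m : ℝ)⁻¹ * v 0, (m : ℝ)⁻¹ * v 1,
      (m : ℝ) ^ 2 * (v 2 - midpt N c.1 * v 0 - midpt N c.2 * v 1)] := by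
  have hm' : (m : ℝ) ≠ 0 := by exact_mod_cast hm.ne'
  rw [stepMat, dual_mul, Matrix.SpecialLinearGroup.coe_mul, ← mulVec_mulVec]
  simp only [dual, Matrix.SpecialLinearGroup.coe_transpose, Matrix.SpecialLinearGroup.coe_inv]
  rw [g_log_coe hm]
  ext i
  fin_cases i <;>
    simp [horo, mulVec, dotProduct, Fin.sum_univ_three, diagonal, adjugate_fin_three] <;>
    first
      | (left; field_simp)
      | (field_simp; ring)

lemma exists_abs_eq_norm (v : Fin 3 → ℝ) : ‖v‖ = |v 0| ∨ ‖v‖ = |v 1| ∨ ‖v‖ = |v 2| := by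
  obtain ⟨i, -, hi⟩ := Finset.exists_mem_eq_sup' (Finset.univ_nonempty (α := Fin 3))
    fun i ↦ ‖v i‖₊
  have h : ‖v‖ = |v i| := by
    rw [Pi.norm_def, ← Finset.sup'_eq_sup Finset.univ_nonempty, hi]; rfl
  fin_cases i
  · exact Or.inl h
  · exact Or.inr (Or.inl h)
  · exact Or.inr (Or.inr h)

lemma norm_le_mul_stepMat {m : ℕ} (hm : 0 < m) {N : ℕ} (c : Fin N × Fin N) (v : Fin 3 → ℝ) :
    ‖v‖ / (4 * m ^ 2) ≤ ‖(stepMat m N c).1 *ᵥ v‖ := by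
  have hm' : (1 : ℝ) ≤ m := by exact_mod_cast hm
  set y := (stepMat m N c).1 *ᵥ v with hy
  have hy' := stepMat_mulVec hm c v
  rw [← hy] at hy'
  have b0 : |y 0| ≤ ‖y‖ := norm_le_pi_norm y 0
  have b1 : |y 1| ≤ ‖y‖ := norm_le_pi_norm y 1
  have b2 : |y 2| ≤ ‖y‖ := norm_le_pi_norm y 2
  have e0 : y 0 = m * (v 0 + midpt N c.1 * v 2) := by rw [hy']; rfl
  have e1 : y 1 = m * (v 1 + midpt N c.2 * v 2) := by rw [hy']; rfl
  have e2 : y 2 = ((m : ℝ) ^ 2)⁻¹ * v 2 := by rw [hy']; rfl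
  have hY : 0 ≤ ‖y‖ := norm_nonneg _
  have hmm : (m : ℝ) ≤ m ^ 2 := by nlinarith
  have a2 : |v 2| ≤ m ^ 2 * ‖y‖ := by
    rw [e2, abs_mul, abs_of_pos (by positivity), inv_mul_le_iff₀ (by positivity)] at b2
    exact b2
  have aux : ∀ i : Fin N, ∀ z : ℝ, |m * (z + midpt N i * v 2)| ≤ ‖y‖ → |z| ≤ 4 * m ^ 2 * ‖y‖ := by
    intro i z hz
    rw [abs_mul, abs_of_pos (by linarith)] at hz
    have h1 : |midpt N i * v 2| ≤ m ^ 2 * ‖y‖ := by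
      rw [abs_mul]
      exact (mul_le_of_le_one_left (abs_nonneg _) (abs_midpt_le N i)).trans a2
    have h2 : |z + midpt N i * v 2| ≤ ‖y‖ :=
      (le_mul_of_one_le_left (abs_nonneg _) hm').trans hz
    have h3 : |z| ≤ |z + midpt N i * v 2| + |midpt N i * v 2| := by
      have := abs_sub (z + midpt N i * v 2) (midpt N i * v 2)
      rwa [add_sub_cancel_right] at this
    have h4 : ‖y‖ ≤ m ^ 2 * ‖y‖ := le_mul_of_one_le_left hY (hm'.trans hmm)
    linarith
  rw [div_le_iff₀ (by positivity), mul_comm]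
  rw [e0] at b0
  rw [e1] at b1
  have hpos : 0 ≤ m ^ 2 * ‖y‖ := by positivity
  rcases exists_abs_eq_norm v with h | h | h <;> rw [h]
  · exact aux _ _ b0
  · exact aux _ _ b1
  · linarith

lemma norm_le_mul_dual_stepMat {m : ℕ} (hm : 0 < m) {N : ℕ} (c : Fin N × Fin N)
    (v : Fin 3 → ℝ) : ‖v‖ / (4 * m ^ 2) ≤ ‖(dual (stepMat m N c)).1 *ᵥ v‖ := by
  have hm' : (1 : ℝ) ≤ m := by exact_mod_cast hm
  set y := (dual (stepMat m N c)).1 *ᵥ v with hy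
  have hy' := dual_stepMat_mulVec hm c v
  rw [← hy] at hy'
  have b0 : |y 0| ≤ ‖y‖ := norm_le_pi_norm y 0
  have b1 : |y 1| ≤ ‖y‖ := norm_le_pi_norm y 1
  have b2 : |y 2| ≤ ‖y‖ := norm_le_pi_norm y 2
  have e0 : y 0 = (m : ℝ)⁻¹ * v 0 := by rw [hy']; rfl
  have e1 : y 1 = (m : ℝ)⁻¹ * v 1 := by rw [hy']; rfl
  have e2 : y 2 = (m : ℝ) ^ 2 * (v 2 - midpt N c.1 * v 0 - midpt N c.2 * v 1) := by rw [hy']; rfl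
  have hY : 0 ≤ ‖y‖ := norm_nonneg _
  have hmm : (m : ℝ) ≤ m ^ 2 := by nlinarith
  have hmY : m * ‖y‖ ≤ m ^ 2 * ‖y‖ := mul_le_mul_of_nonneg_right hmm hY
  have hpos : 0 ≤ m ^ 2 * ‖y‖ := by positivity
  rw [e0, abs_mul, abs_of_pos (by positivity), inv_mul_le_iff₀ (by positivity)] at b0
  rw [e1, abs_mul, abs_of_pos (by positivity), inv_mul_le_iff₀ (by positivity)] at b1
  rw [e2, abs_mul, abs_of_pos (by positivity)] at b2
  rw [div_le_iff₀ (by positivity), mul_comm]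
  rcases exists_abs_eq_norm v with h | h | h <;> rw [h]
  · linarith
  · linarith
  · have h0 : |midpt N c.1 * v 0| ≤ m * ‖y‖ := by
      rw [abs_mul]
      exact (mul_le_of_le_one_left (abs_nonneg _) (abs_midpt_le N _)).trans b0
    have h1 : |midpt N c.2 * v 1| ≤ m * ‖y‖ := by
      rw [abs_mul]
      exact (mul_le_of_le_one_left (abs_nonneg _) (abs_midpt_le N _)).trans b1
    have h2 : |v 2 - midpt N c.1 * v 0 - midpt N c.2 * v 1| ≤ ‖y‖ :=
      (le_mul_of_one_le_left (abs_nonneg _) (hm'.trans hmm)).trans b2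
    have h4 : ‖y‖ ≤ m ^ 2 * ‖y‖ := le_mul_of_one_le_left hY (hm'.trans hmm)
    have h3 : |v 2| ≤ 4 * m ^ 2 * ‖y‖ := by
      rw [abs_le] at h0 h1 h2 ⊢
      constructor <;> linarith [h0.1, h0.2, h1.1, h1.2, h2.1, h2.2]
    exact h3

/-- Outside of a thin neighbourhood of a line, the matrices of the grid expand a given vector. -/
lemma exists_good_stepMat {m : ℕ} (hm : 0 < m) {ρ : ℝ} (hρ : 0 ≤ ρ) (hρ1 : ρ ≤ 1) (N : ℕ)
    (v : Fin 3 → ℝ) : ∃ β : Fin N → ℝ,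
      (∀ i j, ρ ≤ |midpt N i - β j| → ρ * m * ‖v‖ / 4 ≤ ‖(stepMat m N (i, j)).1 *ᵥ v‖) ∨
      (∀ i j, ρ ≤ |midpt N i - β j| → ρ * m * ‖v‖ / 4 ≤ ‖(stepMat m N (j, i)).1 *ᵥ v‖) := by
  have hm' : (1 : ℝ) ≤ m := by exact_mod_cast hm
  have hL : 0 ≤ ‖v‖ := norm_nonneg _
  have e0 : ∀ c : Fin N × Fin N, m * |v 0 + midpt N c.1 * v 2| ≤ ‖(stepMat m N c).1 *ᵥ v‖ := by
    intro c
    have := norm_le_pi_norm ((stepMat m N c).1 *ᵥ v) 0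
    rw [Real.norm_eq_abs] at this
    refine le_trans (le_of_eq ?_) this
    rw [stepMat_mulVec hm, cons_val_zero, abs_mul (m : ℝ) _,
      abs_of_pos (show (0 : ℝ) < m by linarith)]
  have e1 : ∀ c : Fin N × Fin N, m * |v 1 + midpt N c.2 * v 2| ≤ ‖(stepMat m N c).1 *ᵥ v‖ := by
    intro c
    have := norm_le_pi_norm ((stepMat m N c).1 *ᵥ v) 1
    rw [Real.norm_eq_abs] at this
    refine le_trans (le_of_eq ?_) this
    rw [stepMat_mulVec hm, cons_val_one, cons_val_zero, abs_mul (m : ℝ) _,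
      abs_of_pos (show (0 : ℝ) < m by linarith)]
  rcases le_or_gt (2 * |v 2|) ‖v‖ with h | h
  · have aux : ∀ i : Fin N, ∀ z : ℝ, ‖v‖ = |z| →
        ρ * m * ‖v‖ / 4 ≤ m * |z + midpt N i * v 2| := by
      intro i z hz
      have h1 : |midpt N i * v 2| ≤ ‖v‖ / 2 := by
        rw [abs_mul]
        have := mul_le_of_le_one_left (abs_nonneg (v 2)) (abs_midpt_le N i)
        linarith
      have h3 : |z| ≤ |z + midpt N i * v 2| + |midpt N i * v 2| := by
        have := abs_sub (z + midpt N i * v 2) (midpt N i * v 2)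
        rwa [add_sub_cancel_right] at this
      have h4 : m * (‖v‖ / 2) ≤ m * |z + midpt N i * v 2| :=
        mul_le_mul_of_nonneg_left (by linarith) (by linarith)
      have h5 : ρ * (m * ‖v‖) ≤ m * ‖v‖ := mul_le_of_le_one_left (by positivity) hρ1
      have h6 : 0 ≤ m * ‖v‖ := by positivity
      linarith
    -- There is no bad strip here: one of the first two coordinates dominates and cannot be
    -- cancelled, so any `β` works.
    refine ⟨fun _ ↦ 0, Or.inl fun i j _ ↦ ?_⟩
    rcases exists_abs_eq_norm v with h' | h' | h'
    · exact (aux i _ h').trans (e0 (i, j))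
    · exact (aux j _ h').trans (e1 (i, j))
    · have : ‖v‖ = 0 := by linarith
      rw [this]
      simp
  · have hv2 : v 2 ≠ 0 := by
      intro h0
      rw [h0, abs_zero] at h
      linarith
    -- The strip surrounds the zero of `s ↦ v 0 + s * v 2`, whose slope is comparable to `‖v‖`.
    refine ⟨fun _ ↦ -(v 0 / v 2), Or.inl fun i j hij ↦ le_trans ?_ (e0 (i, j))⟩
    have : v 0 + midpt N i * v 2 = v 2 * (midpt N i - -(v 0 / v 2)) := by
      field_simp; ring
    rw [this, abs_mul]
    have h1 : |v 2| * ρ ≤ |v 2| * |midpt N i - -(v 0 / v 2)| :=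
      mul_le_mul_of_nonneg_left hij (abs_nonneg _)
    have h2 : ‖v‖ / 4 * ρ ≤ |v 2| * ρ := mul_le_mul_of_nonneg_right (by linarith) hρ
    calc ρ * m * ‖v‖ / 4 = m * (‖v‖ / 4 * ρ) := by ring
      _ ≤ _ := mul_le_mul_of_nonneg_left (h2.trans h1) (by linarith)

/-- Only the last coordinate expands, and its zero set is a line in the parameter plane. The line is
solved for whichever grid parameter has a large coefficient, hence the two alternatives. If both
coefficients are small, `v 2` dominates. Of the expansion `m ^ 2` only `m` is used, to match the
estimate for `stepMat`. -/
lemma exists_good_dual_stepMat {m : ℕ} (hm : 0 < m) {ρ : ℝ} (hρ : 0 ≤ ρ) (hρ1 : ρ ≤ 1) (N : ℕ)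
    (v : Fin 3 → ℝ) : ∃ β : Fin N → ℝ,
      (∀ i j, ρ ≤ |midpt N i - β j| → ρ * m * ‖v‖ / 4 ≤ ‖(dual (stepMat m N (i, j))).1 *ᵥ v‖) ∨
      (∀ i j, ρ ≤ |midpt N i - β j| →
        ρ * m * ‖v‖ / 4 ≤ ‖(dual (stepMat m N (j, i))).1 *ᵥ v‖) := by
  have hm' : (1 : ℝ) ≤ m := by exact_mod_cast hm
  have hL : 0 ≤ ‖v‖ := norm_nonneg _
  have hmm : (m : ℝ) ≤ m ^ 2 := by nlinarith
  have e : ∀ c : Fin N × Fin N, m * |v 2 - midpt N c.1 * v 0 - midpt N c.2 * v 1| ≤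
      ‖(dual (stepMat m N c)).1 *ᵥ v‖ := by
    intro c
    have := norm_le_pi_norm ((dual (stepMat m N c)).1 *ᵥ v) 2
    rw [Real.norm_eq_abs] at this
    refine le_trans (mul_le_mul_of_nonneg_right hmm (abs_nonneg _)) (le_trans (le_of_eq ?_) this)
    rw [dual_stepMat_mulVec hm, show (![(m : ℝ)⁻¹ * v 0, (m : ℝ)⁻¹ * v 1,
      (m : ℝ) ^ 2 * (v 2 - midpt N c.1 * v 0 - midpt N c.2 * v 1)] : Fin 3 → ℝ) 2 =
      (m : ℝ) ^ 2 * (v 2 - midpt N c.1 * v 0 - midpt N c.2 * v 1) from rfl,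
      abs_mul ((m : ℝ) ^ 2) _, abs_of_pos (show (0 : ℝ) < (m : ℝ) ^ 2 by positivity)]
  have big : ∀ {x y μ : ℝ}, ‖v‖ < 4 * |x| → ρ ≤ |μ - y / x| →
      ρ * m * ‖v‖ / 4 ≤ m * |y - μ * x| := fun {x y μ} hx h ↦ by
    have hx0 : x ≠ 0 := by
      rintro rfl
      rw [abs_zero] at hx
      linarith
    have : y - μ * x = -(x * (μ - y / x)) := by field_simp; ring
    rw [this, abs_neg, abs_mul]
    have h1 : |x| * ρ ≤ |x| * |μ - y / x| := mul_le_mul_of_nonneg_left h (abs_nonneg _)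
    have h2 : ‖v‖ / 4 * ρ ≤ |x| * ρ := mul_le_mul_of_nonneg_right (by linarith) hρ
    calc ρ * m * ‖v‖ / 4 = m * (‖v‖ / 4 * ρ) := by ring
      _ ≤ _ := mul_le_mul_of_nonneg_left (h2.trans h1) (by linarith)
  rcases lt_or_ge ‖v‖ (4 * |v 0|) with h0 | h0
  · refine ⟨fun j ↦ (v 2 - midpt N j * v 1) / v 0, Or.inl fun i j hij ↦ ?_⟩
    have := big h0 hij
    rw [sub_right_comm] at this
    exact this.trans (e (i, j))
  rcases lt_or_ge ‖v‖ (4 * |v 1|) with h1 | h1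
  · refine ⟨fun j ↦ (v 2 - midpt N j * v 0) / v 1, Or.inr fun i j hij ↦ ?_⟩
    exact (big h1 hij).trans (e (j, i))
  refine ⟨fun _ ↦ 0, Or.inl fun i j _ ↦ le_trans ?_ (e (i, j))⟩
  have hz : ‖v‖ ≤ |v 2| ∨ ‖v‖ = 0 := by
    rcases exists_abs_eq_norm v with h' | h' | h'
    · right; linarith
    · right; linarith
    · left; linarith
  rcases hz with hz | hz
  · have a0 : |midpt N i * v 0| ≤ ‖v‖ / 4 := by
      rw [abs_mul]
      have := mul_le_of_le_one_left (abs_nonneg (v 0)) (abs_midpt_le N i)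
      linarith
    have a1 : |midpt N j * v 1| ≤ ‖v‖ / 4 := by
      rw [abs_mul]
      have := mul_le_of_le_one_left (abs_nonneg (v 1)) (abs_midpt_le N j)
      linarith
    have a2 : ‖v‖ / 2 ≤ |v 2 - midpt N i * v 0 - midpt N j * v 1| := by
      have t1 := abs_sub_abs_le_abs_sub (v 2) (midpt N i * v 0)
      have t2 := abs_sub_abs_le_abs_sub (v 2 - midpt N i * v 0) (midpt N j * v 1)
      linarith
    have a3 := mul_le_mul_of_nonneg_left a2 (by linarith : (0 : ℝ) ≤ m)
    have h5 : ρ * (m * ‖v‖) ≤ m * ‖v‖ := mul_le_of_le_one_left (by positivity) hρ1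
    have h6 : 0 ≤ m * ‖v‖ := by positivity
    simp only at a3 ⊢
    linarith
  · rw [hz]
    simp only [mul_zero, zero_div]
    positivity

end Matrices

/-! ### Choice of constants and contraction of the height -/

section StepContraction

/-- With exponent `1 / 4` and strip width `2 ^ (-23)`, the worst bound contributes a factor `2 ^ 19`
and the good one `1 / 8`. The average is at most `(2 ^ (-23) + 1 / N) * 2 ^ 19 + 1 / 8 < 1 / 4`. -/
lemma sum_stepMat_rpow_le {m N : ℕ} (hm : m = 2 ^ 37) (hN : N = m ^ 3) {v : Fin 3 → ℝ}
    (hv : v ≠ 0) :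
    ∑ c, ‖(stepMat m N c).1 *ᵥ v‖ ^ (-(1 / 4) : ℝ) ≤
        Fintype.card (Fin N × Fin N) / 4 * ‖v‖ ^ (-(1 / 4) : ℝ) ∧
      ∑ c, ‖(dual (stepMat m N c)).1 *ᵥ v‖ ^ (-(1 / 4) : ℝ) ≤
        Fintype.card (Fin N × Fin N) / 4 * ‖v‖ ^ (-(1 / 4) : ℝ) := by
  have hm0 : 0 < m := by rw [hm]; positivity
  have hmR : (m : ℝ) = 2 ^ 37 := by rw [hm]; norm_num
  have hNR : (N : ℝ) = 2 ^ 111 := by rw [hN]; push_cast; rw [hmR]; norm_num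
  have hN0 : 0 < N := by rw [hN]; positivity
  have hL : 0 < ‖v‖ := norm_pos_iff.2 hv
  have hX : (‖v‖ / (4 * (m : ℝ) ^ 2)) ^ (-(1 / 4) : ℝ) = ‖v‖ ^ (-(1 / 4) : ℝ) * 2 ^ 19 := by
    rw [hmR, show (4 * (2 ^ 37) ^ 2 : ℝ) = (2 ^ 19) ^ (4 : ℝ) by norm_num,
      Real.div_rpow hL.le (by positivity), ← Real.rpow_mul (by positivity)]
    norm_num [Real.rpow_neg_one]
    ring
  have hY : ((1 / 2 ^ 23) * (m : ℝ) * ‖v‖ / 4) ^ (-(1 / 4) : ℝ) = ‖v‖ ^ (-(1 / 4) : ℝ) / 8 := by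
    rw [hmR, show (1 / 2 ^ 23 * 2 ^ 37 * ‖v‖ / 4 : ℝ) = ‖v‖ * 8 ^ (4 : ℝ) by norm_num; ring,
      Real.mul_rpow hL.le (by positivity), ← Real.rpow_mul (by positivity)]
    norm_num [Real.rpow_neg_one]
    ring
  have total : ∀ F : Fin N → Fin N → ℝ, (∀ i j, ‖v‖ / (4 * (m : ℝ) ^ 2) ≤ F i j) →
      (∃ β : Fin N → ℝ, ∀ i j, 1 / 2 ^ 23 ≤ |midpt N i - β j| →
        (1 / 2 ^ 23) * (m : ℝ) * ‖v‖ / 4 ≤ F i j) →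
      ∑ j, ∑ i, F i j ^ (-(1 / 4) : ℝ) ≤
        Fintype.card (Fin N × Fin N) / 4 * ‖v‖ ^ (-(1 / 4) : ℝ) := by
    rintro F h1 ⟨β, h2⟩
    have hmpos : (0 : ℝ) < m := by exact_mod_cast hm0
    have := sum_sum_rpow_le hN0 (F := F) (a := 1 / 4) (ρ := 1 / 2 ^ 23)
      (X := ‖v‖ / (4 * (m : ℝ) ^ 2)) (Y := (1 / 2 ^ 23) * (m : ℝ) * ‖v‖ / 4) (by norm_num)
      (by positivity) (by positivity) (by positivity) β h1 h2
    refine this.trans ?_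
    rw [hX, hY, Fintype.card_prod, Fintype.card_fin, Nat.cast_mul, hNR]
    have hp : 0 ≤ ‖v‖ ^ (-(1 / 4) : ℝ) := Real.rpow_nonneg hL.le _
    nlinarith
  constructor
  · obtain ⟨β, h | h⟩ := exists_good_stepMat hm0 (ρ := 1 / 2 ^ 23) (by positivity)
      (by norm_num) N v
    · rw [Fintype.sum_prod_type_right]
      exact total (fun i j ↦ ‖(stepMat m N (i, j)).1 *ᵥ v‖)
        (fun i j ↦ norm_le_mul_stepMat hm0 _ v) ⟨β, h⟩
    · rw [Fintype.sum_prod_type]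
      exact total (fun i j ↦ ‖(stepMat m N (j, i)).1 *ᵥ v‖)
        (fun i j ↦ norm_le_mul_stepMat hm0 _ v) ⟨β, h⟩
  · obtain ⟨β, h | h⟩ := exists_good_dual_stepMat hm0 (ρ := 1 / 2 ^ 23) (by positivity)
      (by norm_num) N v
    · rw [Fintype.sum_prod_type_right]
      exact total (fun i j ↦ ‖(dual (stepMat m N (i, j))).1 *ᵥ v‖)
        (fun i j ↦ norm_le_mul_dual_stepMat hm0 _ v) ⟨β, h⟩
    · rw [Fintype.sum_prod_type]
      exact total (fun i j ↦ ‖(dual (stepMat m N (j, i))).1 *ᵥ v‖)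
        (fun i j ↦ norm_le_mul_dual_stepMat hm0 _ v) ⟨β, h⟩

/-- For high lattices, the average of the height over the grid is at most half of the height. -/
lemma exists_height_contraction : ∃ (m : ℕ) (M : ℝ), 2 ≤ m ∧ 1 ≤ M ∧ ∀ h : G,
    M ≤ height (1 / 4) h → ∑ c, height (1 / 4) (stepMat m (m ^ 3) c * h) ≤
      ((m : ℝ) ^ 3) ^ 2 / 2 * height (1 / 4) h := by
  obtain ⟨m, hm⟩ : ∃ m : ℕ, m = 2 ^ 37 := ⟨_, rfl⟩
  obtain ⟨N, hN⟩ : ∃ N : ℕ, N = m ^ 3 := ⟨_, rfl⟩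
  set r : Fin N × Fin N → ℝ := fun c ↦ ‖(stepMat m N c).1‖ + ‖((stepMat m N c)⁻¹).1‖ +
    ‖(dual (stepMat m N c)).1‖ + ‖((dual (stepMat m N c))⁻¹).1‖ with hr
  have hr0 : ∀ c ∈ Finset.univ, 0 ≤ r c := fun c _ ↦ by positivity
  have hrR : ∀ c, r c ≤ ∑ c, r c := fun c ↦ Finset.single_le_sum hr0 (Finset.mem_univ c)
  have n1 : ∀ c, 0 ≤ ‖(stepMat m N c).1‖ := fun c ↦ norm_nonneg _
  have n2 : ∀ c, 0 ≤ ‖((stepMat m N c)⁻¹).1‖ := fun c ↦ norm_nonneg _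
  have n3 : ∀ c, 0 ≤ ‖(dual (stepMat m N c)).1‖ := fun c ↦ norm_nonneg _
  have n4 : ∀ c, 0 ≤ ‖((dual (stepMat m N c))⁻¹).1‖ := fun c ↦ norm_nonneg _
  obtain ⟨M, hM1, hM⟩ := sum_height_le (B := stepMat m N) (R := ∑ c, r c) (a := 1 / 4)
    (fun c ↦ by linarith [hrR c, n1 c, n2 c, n3 c, n4 c])
    (fun c ↦ by linarith [hrR c, n1 c, n2 c, n3 c, n4 c])
    (fun c ↦ by linarith [hrR c, n1 c, n2 c, n3 c, n4 c])
    (fun c ↦ by linarith [hrR c, n1 c, n2 c, n3 c, n4 c]) (by norm_num)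
    (fun v hv ↦ (sum_stepMat_rpow_le hm hN hv).1) (fun v hv ↦ (sum_stepMat_rpow_le hm hN hv).2)
  refine ⟨m, M, by rw [hm]; norm_num, hM1, fun h hh ↦ ?_⟩
  have := hM h hh
  rw [Fintype.card_prod, Fintype.card_fin, Nat.cast_mul, ← sq] at this
  subst hN
  rw [Nat.cast_pow] at this
  exact this

end StepContraction

/-! ### Covering the parameters with persistently short vectors -/

section Covering

/-- The set `E` is covered by at most `k` balls of radius `r`. -/
def IsCoveredBy (E : Set (ℝ × ℝ)) (k r : ℝ) : Prop :=
  ∃ F : Finset (ℝ × ℝ), (F.card : ℝ) ≤ k ∧ ∀ s ∈ E, ∃ c ∈ F, dist s c ≤ r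

lemma IsCoveredBy.mono {E : Set (ℝ × ℝ)} {k k' r : ℝ} (h : IsCoveredBy E k r) (hk : k ≤ k') :
    IsCoveredBy E k' r := by
  obtain ⟨F, hF, hE⟩ := h
  exact ⟨F, hF.trans hk, hE⟩

lemma isCoveredBy_empty {k r : ℝ} (hk : 0 ≤ k) : IsCoveredBy ∅ k r :=
  ⟨∅, by simpa using hk, by simp⟩

/-- The point of the product grid with index `c`. -/
noncomputable def gridPt (N : ℕ) (c : Fin N × Fin N) : ℝ × ℝ := (midpt N c.1, midpt N c.2)

lemma exists_eq_gridPt_add {N : ℕ} (hN : 0 < N) {s : ℝ × ℝ} (hs : ‖s‖ ≤ 1) :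
    ∃ c, ∃ t : ℝ × ℝ, ‖t‖ ≤ 1 ∧ s = gridPt N c + (N : ℝ)⁻¹ • t := by
  have hN' : (0 : ℝ) < N := by exact_mod_cast hN
  obtain ⟨i, hi⟩ := exists_abs_sub_midpt_le hN ((norm_fst_le s).trans hs)
  obtain ⟨j, hj⟩ := exists_abs_sub_midpt_le hN ((norm_snd_le s).trans hs)
  refine ⟨(i, j), (N : ℝ) • (s - gridPt N (i, j)), ?_, ?_⟩
  · rw [norm_smul, Real.norm_of_nonneg hN'.le, ← le_div_iff₀' hN']
    exact max_le hi hj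
  · rw [inv_smul_smul₀ hN'.ne']
    abel

lemma isCoveredBy_of_children {N : ℕ} (hN : 0 < N) {E : Set (ℝ × ℝ)} (hE : ∀ s ∈ E, ‖s‖ ≤ 1)
    {E' : Fin N × Fin N → Set (ℝ × ℝ)}
    (hE' : ∀ c t, ‖t‖ ≤ 1 → gridPt N c + (N : ℝ)⁻¹ • t ∈ E → t ∈ E' c)
    {k : Fin N × Fin N → ℝ} {r : ℝ} (hk : ∀ c, IsCoveredBy (E' c) (k c) r) :
    IsCoveredBy E (∑ c, k c) (r / N) := by
  classical
  have hN' : (0 : ℝ) < N := by exact_mod_cast hN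
  choose F hF hFE using hk
  refine ⟨Finset.univ.biUnion fun c ↦ (F c).image fun t ↦ gridPt N c + (N : ℝ)⁻¹ • t, ?_, ?_⟩
  · refine le_trans (b := ((∑ c, (F c).card : ℕ) : ℝ)) ?_ ?_
    · exact_mod_cast Finset.card_biUnion_le.trans
        (Finset.sum_le_sum fun c _ ↦ Finset.card_image_le)
    · push_cast
      exact Finset.sum_le_sum fun c _ ↦ hF c
  · intro s hs
    obtain ⟨c, t, ht, rfl⟩ := exists_eq_gridPt_add hN (hE s hs)
    obtain ⟨x, hx, hd⟩ := hFE c t (hE' c t ht hs)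
    refine ⟨gridPt N c + (N : ℝ)⁻¹ • x, Finset.mem_biUnion.2
      ⟨c, Finset.mem_univ _, Finset.mem_image_of_mem _ hx⟩, ?_⟩
    rw [dist_add_left, dist_smul₀, Real.norm_of_nonneg (by positivity), inv_mul_eq_div]
    exact div_le_div_of_nonneg_right hd hN'.le

/-- The parameters `s` in the unit square for which the lattice `horo s * h` has short vectors at
the times `n₀, …, n₀ + n` of the discretized flow. -/
def shortAt (m : ℕ) (δ : ℝ) (n₀ n : ℕ) (h : G) : Set (ℝ × ℝ) :=
  {s | ‖s‖ ≤ 1 ∧ ∀ k, n₀ ≤ k → k ≤ n₀ + n → minLen (g (Real.log m) ^ k * (horo s * h)) < δ}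

/-- Self-similarity of the flow: conjugation by `g (log m)` expands `horo` by `m ^ 3`, exactly
undoing the subdivision. -/
lemma pow_succ_mul_horo {m : ℕ} (hm : 0 < m) (k : ℕ) (c : Fin (m ^ 3) × Fin (m ^ 3)) (t : ℝ × ℝ)
    (h : G) :
    g (Real.log m) ^ (k + 1) * (horo (gridPt (m ^ 3) c + ((m ^ 3 : ℕ) : ℝ)⁻¹ • t) * h) =
      g (Real.log m) ^ k * (horo t * (stepMat m (m ^ 3) c * h)) := by
  have hm' : (0 : ℝ) < m := by exact_mod_cast hm
  have h1 : g (Real.log m) * horo (((m ^ 3 : ℕ) : ℝ)⁻¹ • t) = horo t * g (Real.log m) := by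
    rw [g_mul_horo, smul_smul]
    have : Real.exp (3 * Real.log m) * ((m ^ 3 : ℕ) : ℝ)⁻¹ = 1 := by
      rw [show 3 * Real.log m = ((3 : ℕ) : ℝ) * Real.log m by norm_num, Real.exp_nat_mul,
        Real.exp_log hm']
      push_cast
      exact mul_inv_cancel₀ (by positivity)
    rw [this, one_smul]
  rw [add_comm (gridPt _ c), horo_add, pow_succ, stepMat, ← gridPt]
  simp only [mul_assoc]
  rw [← mul_assoc (g _) (horo _), h1, mul_assoc]

lemma mem_shortAt_of_succ {m : ℕ} (hm : 0 < m) {δ : ℝ} {n₀ n n₀' n' : ℕ} {h : G}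
    {c : Fin (m ^ 3) × Fin (m ^ 3)} {t : ℝ × ℝ} (ht : ‖t‖ ≤ 1)
    (hs : gridPt (m ^ 3) c + ((m ^ 3 : ℕ) : ℝ)⁻¹ • t ∈ shortAt m δ n₀ n h)
    (h₁ : n₀ ≤ n₀' + 1) (h₂ : n₀' + n' + 1 ≤ n₀ + n) :
    t ∈ shortAt m δ n₀' n' (stepMat m (m ^ 3) c * h) := by
  refine ⟨ht, fun k hk hk' ↦ ?_⟩
  rw [← pow_succ_mul_horo hm]
  exact hs.2 (k + 1) (by omega) (by omega)

/-- Carrying the height of `h` in the bound makes the induction close: the children's bounds add up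
to a sum of heights, which the contraction halves relative to the number of cells. -/
lemma isCoveredBy_shortAt_zero {m : ℕ} (hm : 0 < m) {M δ : ℝ} (hM1 : 1 ≤ M)
    (hM : ∀ h : G, M ≤ height (1 / 4) h → ∑ c, height (1 / 4) (stepMat m (m ^ 3) c * h) ≤
      ((m : ℝ) ^ 3) ^ 2 / 2 * height (1 / 4) h)
    (hδ : ∀ h : G, minLen h < 2 * δ → M ≤ height (1 / 4) h) (n : ℕ) (h : G) :
    IsCoveredBy (shortAt m δ 0 n h) ((((m : ℝ) ^ 3) ^ 2 / 2) ^ n * height (1 / 4) h)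
      (1 / ((m ^ 3 : ℕ) : ℝ) ^ n) := by
  have hpos : ∀ n : ℕ, ∀ h : G, 0 ≤ (((m : ℝ) ^ 3) ^ 2 / 2) ^ n * height (1 / 4) h := fun n h ↦
    mul_nonneg (by positivity) (height_pos _ _).le
  -- Contraction is available whenever there is anything to cover: a short vector of `horo s * h` at
  -- time 0 gives one of `h`, at most twice as long.
  have hne : ∀ n : ℕ, ∀ h : G, (shortAt m δ 0 n h).Nonempty → M ≤ height (1 / 4) h := by
    rintro n h ⟨s, hs, hk⟩
    apply hδ
    have h1 := hk 0 le_rfl (Nat.zero_le _)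
    rw [pow_zero, one_mul] at h1
    have h2 := minLen_le_mul h (horo s)
    rw [← horo_neg] at h2
    have h3 : ‖(horo (-s)).1‖ ≤ 2 := by
      refine norm_horo_le ?_ ?_
      · rw [Prod.fst_neg, abs_neg]; exact (norm_fst_le s).trans hs
      · rw [Prod.snd_neg, abs_neg]; exact (norm_snd_le s).trans hs
    have h4 := mul_le_mul_of_nonneg_right h3 (minLen_pos (horo s * h)).le
    linarith
  induction n generalizing h with
  | zero =>
    rcases Set.eq_empty_or_nonempty (shortAt m δ 0 0 h) with h0 | h0
    · rw [h0]; exact isCoveredBy_empty (hpos _ _)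
    · have h1 := hM1.trans (hne _ _ h0)
      -- One unit ball is enough, and the bound allows it because the height is at least 1.
      refine ⟨{0}, by simpa using h1, fun s hs ↦ ⟨0, by simp, ?_⟩⟩
      simpa using hs.1
  | succ n ih =>
    rcases Set.eq_empty_or_nonempty (shortAt m δ 0 (n + 1) h) with h0 | h0
    · rw [h0]; exact isCoveredBy_empty (hpos _ _)
    · have h1 := hM h (hne _ _ h0)
      have h2 := isCoveredBy_of_children (N := m ^ 3) (by positivity)
        (E := shortAt m δ 0 (n + 1) h) (fun s hs ↦ hs.1)
        (fun c t ht hs ↦ mem_shortAt_of_succ hm ht hs (Nat.zero_le _) (n' := n) (by omega))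
        (fun c ↦ ih (stepMat m (m ^ 3) c * h))
      rw [div_div, ← pow_succ] at h2
      refine h2.mono ?_
      rw [← Finset.mul_sum, pow_succ _ n, mul_assoc]
      exact mul_le_mul_of_nonneg_left h1 (by positivity)

/-- During the first `n₀` steps nothing is known, so all children are kept; this affects only the
constant. -/
lemma exists_isCoveredBy_shortAt {m : ℕ} (hm : 0 < m) {M δ : ℝ} (hM1 : 1 ≤ M)
    (hM : ∀ h : G, M ≤ height (1 / 4) h → ∑ c, height (1 / 4) (stepMat m (m ^ 3) c * h) ≤
      ((m : ℝ) ^ 3) ^ 2 / 2 * height (1 / 4) h)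
    (hδ : ∀ h : G, minLen h < 2 * δ → M ≤ height (1 / 4) h) (n₀ : ℕ) (h : G) :
    ∃ C : ℝ, 0 ≤ C ∧ ∀ n, IsCoveredBy (shortAt m δ n₀ n h) (C * (((m : ℝ) ^ 3) ^ 2 / 2) ^ n)
      (1 / ((m ^ 3 : ℕ) : ℝ) ^ (n₀ + n)) := by
  induction n₀ generalizing h with
  | zero =>
    refine ⟨height (1 / 4) h, (height_pos _ _).le, fun n ↦ ?_⟩
    rw [mul_comm, zero_add]
    exact isCoveredBy_shortAt_zero hm hM1 hM hδ n h
  | succ n₀ ih =>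
    choose C hC0 hC using ih
    refine ⟨∑ c, C (stepMat m (m ^ 3) c * h), Finset.sum_nonneg fun _ _ ↦ hC0 _, fun n ↦ ?_⟩
    have h2 := isCoveredBy_of_children (N := m ^ 3) (by positivity)
      (E := shortAt m δ (n₀ + 1) n h) (fun s hs ↦ hs.1)
      (fun c t ht hs ↦ mem_shortAt_of_succ hm ht hs le_rfl (n' := n) (by omega))
      (fun c ↦ hC (stepMat m (m ^ 3) c * h) n)
    rw [div_div, ← pow_succ] at h2
    rw [Finset.sum_mul, show n₀ + 1 + n = n₀ + n + 1 by ring]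
    exact h2

lemma exists_le_height (M : ℝ) (hM : 1 ≤ M) :
    ∃ δ : ℝ, 0 < δ ∧ ∀ h : G, minLen h < 2 * δ → M ≤ height (1 / 4) h := by
  refine ⟨(M ^ (4 : ℕ))⁻¹ / 2, by positivity, fun h hh ↦ ?_⟩
  rw [mul_div_cancel₀ _ (two_ne_zero' ℝ)] at hh
  have h1 := Real.rpow_le_rpow_of_nonpos (minLen_pos h) hh.le
    (show (-(1 / 4) : ℝ) ≤ 0 by norm_num)
  have h2 : ((M ^ (4 : ℕ))⁻¹) ^ (-(1 / 4) : ℝ) = M := by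
    have hM0 : 0 ≤ M := by linarith
    rw [Real.rpow_neg (by positivity), Real.inv_rpow (by positivity), inv_inv,
      ← Real.rpow_natCast, ← Real.rpow_mul hM0]
    norm_num
  rw [h2] at h1
  have h3 : 0 ≤ minLen (dual h) ^ (-(1 / 4) : ℝ) := Real.rpow_nonneg (minLen_pos _).le _
  unfold height
  linarith

end Covering

/-! ### The non-expanded directions and local product charts -/

section Parabolic

lemma row_sum_le_norm (M : Matrix (Fin 3) (Fin 3) ℝ) (i : Fin 3) :
    |M i 0| + |M i 1| + |M i 2| ≤ ‖M‖ := by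
  have h : ∑ j, ‖M i j‖₊ ≤ Finset.univ.sup fun i ↦ ∑ j, ‖M i j‖₊ :=
    Finset.le_sup (f := fun i ↦ ∑ j, ‖M i j‖₊) (Finset.mem_univ i)
  rw [linfty_opNorm_def]
  rw [← NNReal.coe_le_coe, Fin.sum_univ_three] at h
  simpa using h

lemma abs_entry_le_norm (M : Matrix (Fin 3) (Fin 3) ℝ) (i j : Fin 3) : |M i j| ≤ ‖M‖ := by
  refine le_trans ?_ (row_sum_le_norm M i)
  have h0 := abs_nonneg (M i 0)
  have h1 := abs_nonneg (M i 1)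
  have h2 := abs_nonneg (M i 2)
  fin_cases j <;> simp <;> linarith

/-- A bounded part of the subgroup of elements not expanded under conjugation by `g t`, `t ≥ 0`. -/
def parab : Set G := {p | p.1 0 2 = 0 ∧ p.1 1 2 = 0 ∧ ‖p.1‖ ≤ 2 ∧ ‖(p⁻¹).1‖ ≤ 2}

lemma inv_mem_parab {p : G} (hp : p ∈ parab) : p⁻¹ ∈ parab := by
  obtain ⟨h0, h1, h2, h3⟩ := hp
  refine ⟨?_, ?_, h3, by rwa [inv_inv]⟩
  · rw [Matrix.SpecialLinearGroup.coe_inv, adjugate_fin_three]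
    simp [h0, h1]
  · rw [Matrix.SpecialLinearGroup.coe_inv, adjugate_fin_three]
    simp [h0, h1]

lemma norm_conj_le {p : G} (hp : p ∈ parab) {t : ℝ} (ht : 0 ≤ t) :
    ‖(g t * p * g (-t)).1‖ ≤ 2 := by
  obtain ⟨h0, h1, h2, -⟩ := hp
  have hexp : Real.exp t * Real.exp (-t) = 1 := by
    rw [← Real.exp_add, add_neg_cancel, Real.exp_zero]
  have hexp2 : Real.exp (-(2 * t)) * Real.exp (2 * t) = 1 := by
    rw [← Real.exp_add, neg_add_cancel, Real.exp_zero]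
  have hexp3 : Real.exp (-(2 * t)) * Real.exp (-t) ≤ 1 := by
    rw [← Real.exp_add, Real.exp_le_one_iff]; linarith
  have hexp0 : 0 ≤ Real.exp (-(2 * t)) * Real.exp (-t) := by positivity
  have e : ∀ i j, (g t * p * g (-t)).1 i j =
      ![Real.exp t, Real.exp t, Real.exp (-2 * t)] i * p.1 i j *
        ![Real.exp (-t), Real.exp (-t), Real.exp (-2 * -t)] j := fun i j ↦ by
    rw [Matrix.SpecialLinearGroup.coe_mul, Matrix.SpecialLinearGroup.coe_mul]
    simp only [g, mul_diagonal, diagonal_mul]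
  have hrow := row_sum_le_norm p.1
  refine norm_le_of_entries (by norm_num) fun i ↦ ?_
  refine le_trans ?_ ((hrow i).trans h2)
  simp only [e]
  have key : ∀ x : ℝ, Real.exp t * x * Real.exp (-t) = x := fun x ↦ by
    linear_combination x * hexp
  have key2 : ∀ x : ℝ, Real.exp (-(2 * t)) * x * Real.exp (2 * t) = x := fun x ↦ by
    linear_combination x * hexp2
  have key3 : ∀ x : ℝ, |Real.exp (-(2 * t)) * x * Real.exp (-t)| ≤ |x| := fun x ↦ by
    rw [mul_right_comm, abs_mul, abs_of_nonneg hexp0]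
    exact mul_le_of_le_one_left (abs_nonneg _) hexp3
  fin_cases i
  · simp [key, h0]
  · simp [key, h1]
  · have a := (le_abs_self _).trans (key3 |p.1 2 0|)
    have b := (le_abs_self _).trans (key3 |p.1 2 1|)
    rw [abs_abs] at a b
    simp [key2]
    linarith

/-- Moving `p` past `g t` replaces it by a conjugate, which stays bounded for `t ≥ 0`. -/
lemma minLen_g_mul_le {p : G} (hp : p ∈ parab) {t : ℝ} (ht : 0 ≤ t) (h : G) :
    minLen (g t * h) ≤ 2 * minLen (g t * (p * h)) := by
  have hg : g (-t) * g t = 1 := by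
    rw [← g_add, neg_add_cancel]
    apply Subtype.ext
    rw [Matrix.SpecialLinearGroup.coe_one, ← diagonal_one]
    simp only [g]
    congr 1
    ext i
    fin_cases i <;> simp
  have hinv : (g t * p * g (-t))⁻¹ = g t * p⁻¹ * g (-t) := by
    rw [inv_eq_iff_mul_eq_one]
    calc g t * p * g (-t) * (g t * p⁻¹ * g (-t))
        = g t * p * (g (-t) * g t) * p⁻¹ * g (-t) := by group
      _ = g t * g (-t) := by rw [hg]; group
      _ = 1 := by rw [← hg, ← g_add, ← g_add, add_comm]
  have h1 := minLen_le_mul (g t * h) (g t * p * g (-t))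
  rw [hinv] at h1
  have e : g t * p * g (-t) * (g t * h) = g t * (p * h) := by
    calc _ = g t * p * (g (-t) * g t) * h := by group
      _ = _ := by rw [hg]; group
  rw [e] at h1
  exact h1.trans (mul_le_mul_of_nonneg_right (norm_conj_le (inv_mem_parab hp) ht)
    (minLen_pos _).le)

lemma continuous_entry (i j : Fin 3) : Continuous fun w : G ↦ w.1 i j :=
  (continuous_apply_apply i j).comp continuous_subtype_val

lemma continuous_horo : Continuous horo := by
  refine Continuous.subtype_mk ?_ _
  refine continuous_matrix fun i j ↦ ?_
  fin_cases i <;> fin_cases j <;> simp <;> fun_prop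

lemma exists_parab_mul_horo :
    ∀ᶠ w : G in 𝓝 1, ∃ p ∈ parab, ∃ s : ℝ × ℝ, ‖s‖ ≤ 1 ∧ w = p * horo s := by
  set D : G → ℝ := fun w ↦ w.1 0 0 * w.1 1 1 - w.1 0 1 * w.1 1 0 with hD
  -- Cramer's rule for the condition that the first two entries of the last column of `w * horo
  -- (-s)` vanish.
  set s : G → ℝ × ℝ := fun w ↦ ((w.1 0 2 * w.1 1 1 - w.1 0 1 * w.1 1 2) / D w,
    (w.1 0 0 * w.1 1 2 - w.1 1 0 * w.1 0 2) / D w) with hs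
  have hc := continuous_entry
  have hDc : Continuous D :=
    ((hc 0 0).mul (hc 1 1)).sub ((hc 0 1).mul (hc 1 0))
  have hD1 : D 1 = 1 := by simp [hD]
  have hs1 : s 1 = 0 := by simp [hs]
  have hsc : ContinuousAt s 1 := by
    refine ContinuousAt.prodMk (ContinuousAt.div ?_ hDc.continuousAt (by rw [hD1]; norm_num))
      (ContinuousAt.div ?_ hDc.continuousAt (by rw [hD1]; norm_num))
    · exact (((hc 0 2).mul (hc 1 1)).sub ((hc 0 1).mul (hc 1 2))).continuousAt
    · exact (((hc 0 0).mul (hc 1 2)).sub ((hc 1 0).mul (hc 0 2))).continuousAt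
  have hqc : ContinuousAt (fun w ↦ w * horo (-(s w))) 1 :=
    continuousAt_id.mul (continuous_horo.continuousAt.comp hsc.neg)
  have hq1 : (1 : G) * horo (-(s 1)) = 1 := by rw [hs1, neg_zero, horo_zero, mul_one]
  have hnorm1 : ‖(1 : G).1‖ < 2 := by
    refine lt_of_le_of_lt (norm_le_of_entries (r := 1) (by norm_num) fun i ↦ ?_) one_lt_two
    rw [Matrix.SpecialLinearGroup.coe_one]
    fin_cases i <;> simp [Matrix.one_apply]
  have hnc : Continuous fun w : G ↦ ‖w.1‖ := continuous_norm.comp continuous_subtype_val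
  have hnc' : Continuous fun w : G ↦ ‖(w⁻¹).1‖ := hnc.comp continuous_inv
  have E1 : ∀ᶠ w in 𝓝 (1 : G), D w ≠ 0 :=
    hDc.continuousAt.eventually_ne (by rw [hD1]; norm_num)
  have E2 : ∀ᶠ w in 𝓝 (1 : G), ‖s w‖ < 1 :=
    hsc.norm.eventually_lt continuousAt_const (by rw [hs1, norm_zero]; norm_num)
  have E3 : ∀ᶠ w in 𝓝 (1 : G), ‖(w * horo (-(s w))).1‖ < 2 :=
    ContinuousAt.eventually_lt (f := fun w : G ↦ ‖(w * horo (-(s w))).1‖)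
      (hnc.continuousAt.comp hqc) continuousAt_const (by rw [hq1]; exact hnorm1)
  have E4 : ∀ᶠ w in 𝓝 (1 : G), ‖((w * horo (-(s w)))⁻¹).1‖ < 2 :=
    ContinuousAt.eventually_lt (f := fun w : G ↦ ‖((w * horo (-(s w)))⁻¹).1‖)
      (hnc'.continuousAt.comp hqc) continuousAt_const (by rw [hq1, inv_one]; exact hnorm1)
  filter_upwards [E1, E2, E3, E4] with w h1 h2 h3 h4
  refine ⟨w * horo (-(s w)), ⟨?_, ?_, h3.le, h4.le⟩, s w, h2.le, ?_⟩
  · rw [Matrix.SpecialLinearGroup.coe_mul]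
    simp only [horo, mul_apply, Fin.sum_univ_three, hs]
    simp
    field_simp
    simp only [hD]
    ring
  · rw [Matrix.SpecialLinearGroup.coe_mul]
    simp only [horo, mul_apply, Fin.sum_univ_three, hs]
    simp
    field_simp
    simp only [hD]
    ring
  · rw [mul_assoc, ← horo_add, neg_add_cancel, horo_zero, mul_one]

/-- The six entries of the first two columns are coordinates on `parab`: the corner entry is the
inverse of the upper left minor, hence Lipschitz in them. The constant is `4 + 4 + 128`. -/
lemma norm_sub_le_of_mem_parab {p q : G} (hp : p ∈ parab) (hq : q ∈ parab) {r : ℝ} (hr : 0 ≤ r)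
    (h : ∀ i (j : Fin 2), |p.1 i j.castSucc - q.1 i j.castSucc| ≤ 4 * r) :
    ‖p.1 - q.1‖ ≤ 136 * r := by
  obtain ⟨hp0, hp1, hp2, -⟩ := hp
  obtain ⟨hq0, hq1, hq2, -⟩ := hq
  have bp := fun i j ↦ (abs_entry_le_norm p.1 i j).trans hp2
  have bq := fun i j ↦ (abs_entry_le_norm q.1 i j).trans hq2
  have h0 : ∀ i, |p.1 i 0 - q.1 i 0| ≤ 4 * r := fun i ↦ h i 0
  have h1 : ∀ i, |p.1 i 1 - q.1 i 1| ≤ 4 * r := fun i ↦ h i 1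
  have dp : p.1 2 2 * (p.1 0 0 * p.1 1 1 - p.1 0 1 * p.1 1 0) = 1 := by
    have := p.2
    rw [det_fin_three, hp0, hp1] at this
    linarith
  have dq : q.1 2 2 * (q.1 0 0 * q.1 1 1 - q.1 0 1 * q.1 1 0) = 1 := by
    have := q.2
    rw [det_fin_three, hq0, hq1] at this
    linarith
  have prod : ∀ {a b c d : ℝ}, |a| ≤ 2 → |d| ≤ 2 → |a - c| ≤ 4 * r → |b - d| ≤ 4 * r →
      |a * b - c * d| ≤ 16 * r := fun {a b c d} ha hd hac hbd ↦ by
    have e : a * b - c * d = a * (b - d) + (a - c) * d := by ring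
    rw [e]
    refine (abs_add_le _ _).trans ?_
    rw [abs_mul, abs_mul]
    have t1 := mul_le_mul ha hbd (abs_nonneg _) zero_le_two
    have t2 := mul_le_mul hac hd (abs_nonneg _) (by positivity)
    linarith
  have h22 : |p.1 2 2 - q.1 2 2| ≤ 128 * r := by
    have e : p.1 2 2 - q.1 2 2 = p.1 2 2 * q.1 2 2 *
        ((p.1 0 1 * p.1 1 0 - q.1 0 1 * q.1 1 0) - (p.1 0 0 * p.1 1 1 - q.1 0 0 * q.1 1 1)) := by
      linear_combination q.1 2 2 * dp - p.1 2 2 * dq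
    have t1 := prod (bp 0 1) (bq 1 0) (h1 0) (h0 1)
    have t2 := prod (bp 0 0) (bq 1 1) (h0 0) (h1 1)
    have t3 := abs_sub (p.1 0 1 * p.1 1 0 - q.1 0 1 * q.1 1 0)
      (p.1 0 0 * p.1 1 1 - q.1 0 0 * q.1 1 1)
    have t4 : |p.1 2 2 * q.1 2 2| ≤ 4 := by
      rw [abs_mul]
      have := mul_le_mul (bp 2 2) (bq 2 2) (abs_nonneg _) zero_le_two
      linarith
    rw [e, abs_mul]
    have t5 := mul_le_mul t4 (t3.trans (add_le_add t1 t2)) (abs_nonneg _) (by norm_num)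
    linarith
  refine norm_le_of_entries (by positivity) fun i ↦ ?_
  simp only [Matrix.sub_apply]
  have a0 := h0 i
  have a1 := h1 i
  have a2 : |p.1 i 2 - q.1 i 2| ≤ 128 * r := by
    fin_cases i
    · simp only [Fin.zero_eta, hp0, hq0, sub_self, abs_zero]; positivity
    · simp only [Fin.mk_one, hp1, hq1, sub_self, abs_zero]; positivity
    · exact h22
  linarith

lemma len_le (w : G) : len w ≤ max ‖w.1 - 1‖ ‖(w⁻¹).1 - 1‖ := by
  have h0 : 0 ≤ max ‖w.1 - 1‖ ‖(w⁻¹).1 - 1‖ := le_max_of_le_left (norm_nonneg _)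
  have := Real.log_le_sub_one_of_pos (x := 1 + max ‖w.1 - 1‖ ‖(w⁻¹).1 - 1‖) (by linarith)
  unfold len
  linarith

lemma distG_le {v w : G} {r : ℝ} (hv : ‖(v⁻¹).1‖ ≤ r) (hw : ‖(w⁻¹).1‖ ≤ r) :
    distG v w ≤ ‖v.1 - w.1‖ * r := by
  have key : ∀ a b : G, ‖(b⁻¹).1‖ ≤ r → ‖(a * b⁻¹).1 - 1‖ ≤ ‖a.1 - b.1‖ * r := fun a b hb ↦ by
    have e : (a * b⁻¹).1 - 1 = (a.1 - b.1) * (b⁻¹).1 := by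
      rw [sub_mul, ← Matrix.SpecialLinearGroup.coe_mul, ← Matrix.SpecialLinearGroup.coe_mul,
        mul_inv_cancel, Matrix.SpecialLinearGroup.coe_one]
    rw [e]
    exact (norm_mul_le _ _).trans (mul_le_mul_of_nonneg_left hb (norm_nonneg _))
  refine (len_le _).trans (max_le (key v w hw) ?_)
  rw [_root_.mul_inv_rev, inv_inv, norm_sub_rev v.1]
  exact key w v hv

/-- Right invariance of `distG` removes `k`. The constant is `4 * (136 * 2 + 2 * 2)`, the outer 4
bounding the inverses. -/
lemma dist_parab_mul_horo_le {p q : G} (hp : p ∈ parab) (hq : q ∈ parab) {r : ℝ} (hr : 0 ≤ r)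
    (h : ∀ i (j : Fin 2), |p.1 i j.castSucc - q.1 i j.castSucc| ≤ 4 * r) {s t : ℝ × ℝ}
    (hs : ‖s‖ ≤ 1) (ht : ‖t‖ ≤ 1) (hst : dist s t ≤ 2 * r) (k : G) :
    dist ((p * horo s * k : G) : X) ((q * horo t * k : G) : X) ≤ 1104 * r := by
  have nh : ∀ {s : ℝ × ℝ}, ‖s‖ ≤ 1 → ‖(horo s).1‖ ≤ 2 := fun {s} hs ↦
    norm_horo_le ((norm_fst_le s).trans hs) ((norm_snd_le s).trans hs)
  have ninv : ∀ {p : G} {s : ℝ × ℝ}, p ∈ parab → ‖s‖ ≤ 1 → ‖((p * horo s)⁻¹).1‖ ≤ 4 := by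
    intro p s hp hs
    rw [_root_.mul_inv_rev, ← horo_neg, Matrix.SpecialLinearGroup.coe_mul]
    have h1 := mul_le_mul (nh (s := -s) (by rwa [norm_neg])) hp.2.2.2 (norm_nonneg _) zero_le_two
    exact (norm_mul_le _ _).trans (by linarith)
  have hd : dist ((p * horo s * k : G) : X) ((q * horo t * k : G) : X) ≤
      distG (p * horo s) (q * horo t) := by
    have h1 : dist ((p * horo s * k : G) : X) ((q * horo t * k : G) : X) ≤
      distG (p * horo s * k) (q * horo t * k) := distX_le _ _
    have h2 : distG (p * horo s * k) (q * horo t * k) = distG (p * horo s) (q * horo t) := by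
      unfold distG
      congr 1
      group
    rwa [h2] at h1
  refine hd.trans ((distG_le (ninv hp hs) (ninv hq ht)).trans ?_)
  have hhoro : ‖(horo s).1 - (horo t).1‖ ≤ 2 * r := by
    have h1 : |s.1 - t.1| ≤ 2 * r := (le_max_left _ _).trans hst
    have h2 : |s.2 - t.2| ≤ 2 * r := (le_max_right _ _).trans hst
    refine norm_le_of_entries (by positivity) fun i ↦ ?_
    fin_cases i <;> simp [horo] <;> assumption
  have e : (p * horo s).1 - (q * horo t).1 =
      (p.1 - q.1) * (horo s).1 + q.1 * ((horo s).1 - (horo t).1) := by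
    rw [Matrix.SpecialLinearGroup.coe_mul, Matrix.SpecialLinearGroup.coe_mul]
    noncomm_ring
  have h3 : ‖(p * horo s).1 - (q * horo t).1‖ ≤ 136 * r * 2 + 2 * (2 * r) := by
    rw [e]
    refine (norm_add_le _ _).trans (add_le_add ((norm_mul_le _ _).trans ?_)
      ((norm_mul_le _ _).trans ?_))
    · exact mul_le_mul (norm_sub_le_of_mem_parab hp hq hr h) (nh hs) (norm_nonneg _)
        (by positivity)
    · exact mul_le_mul hq.2.2.1 hhoro (norm_nonneg _) zero_le_two
  linarith

end Parabolic

/-! ### Hausdorff measure of the avoiding set in a chart -/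

section Dimension

open MeasureTheory ENNReal

/-- The points of the chart of `G/Γ` around the coset of `h` whose trajectory avoids `K` after
time `T`. -/
def chartAvoiding (K : Set X) (T : ℝ) (h : G) : Set X :=
  {x | ∃ p ∈ parab, ∃ s : ℝ × ℝ, ‖s‖ ≤ 1 ∧ x = (p * horo s * h : G) ∧ ∀ t, T < t → g t • x ∉ K}

lemma g_nat_mul (t : ℝ) (k : ℕ) : g (k * t) = g t ^ k := by
  induction k with
  | zero =>
    apply Subtype.ext
    rw [pow_zero, Matrix.SpecialLinearGroup.coe_one, ← diagonal_one]
    simp only [g]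
    congr 1
    ext i
    fin_cases i <;> simp
  | succ k ih => rw [pow_succ, ← ih, ← g_add]; push_cast; congr 1; ring

lemma mem_shortAt_of_avoid {K : Set X} {δ : ℝ} (hK : ∀ w : G, (w : X) ∉ K → minLen w < δ / 2)
    {m : ℕ} (hm : 2 ≤ m) {T : ℝ} {n₀ : ℕ} (hn₀ : T < n₀ * Real.log m) (n : ℕ) {h p : G}
    (hp : p ∈ parab) {s : ℝ × ℝ} (hs : ‖s‖ ≤ 1)
    (havoid : ∀ t, T < t → g t • ((p * horo s * h : G) : X) ∉ K) : s ∈ shortAt m δ n₀ n h := by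
  have hlog : 0 < Real.log m := Real.log_pos (by exact_mod_cast hm)
  refine ⟨hs, fun k hk _ ↦ ?_⟩
  have hT : T < k * Real.log m :=
    hn₀.trans_le (mul_le_mul_of_nonneg_right (by exact_mod_cast hk) hlog.le)
  have h1 : minLen (g (k * Real.log m) * (p * horo s * h)) < δ / 2 := hK _ (havoid _ hT)
  have h2 := minLen_g_mul_le hp (t := k * Real.log m) (by positivity) (horo s * h)
  rw [← mul_assoc p] at h2
  rw [← g_nat_mul]
  linarith

/-- At scale `r = N ^ (-(n₀ + n))` the factor `parab` needs `r ^ (-6)` boxes and the horospherical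
factor `C * (N ^ 2 / 2) ^ n` balls. As `N ^ ν = 2`, multiplying by `r ^ (8 - ν)` leaves a bound
independent of `n`. -/
lemma hausdorffMeasure_chartAvoiding_ne_top [MeasurableSpace X] [BorelSpace X]
    {K : Set X} {δ : ℝ} (hK : ∀ w : G, (w : X) ∉ K → minLen w < δ / 2) {m : ℕ} (hm : 2 ≤ m)
    (hcov : ∀ (n₀ : ℕ) (h : G), ∃ C : ℝ, 0 ≤ C ∧ ∀ n, IsCoveredBy (shortAt m δ n₀ n h)
      (C * (((m : ℝ) ^ 3) ^ 2 / 2) ^ n) (1 / ((m ^ 3 : ℕ) : ℝ) ^ (n₀ + n)))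
    {d ν : ℝ} (hd : 0 ≤ d) (hdν : d = 8 - ν) (hν : ((m ^ 3 : ℕ) : ℝ) ^ ν = 2) (T : ℝ) (h : G) :
    Measure.hausdorffMeasure d (chartAvoiding K T h) ≠ ∞ := by
  have hlog : 0 < Real.log m := Real.log_pos (by exact_mod_cast hm)
  obtain ⟨n₀, hn₀⟩ := exists_nat_gt (T / Real.log m)
  rw [div_lt_iff₀ hlog] at hn₀
  obtain ⟨C, hC0, hC⟩ := hcov n₀ h
  obtain ⟨N, hN⟩ : ∃ N : ℕ, N = m ^ 3 := ⟨_, rfl⟩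
  have hNm : (m : ℝ) ^ 3 = N := by rw [hN]; push_cast; rfl
  rw [← hN] at hν
  rw [hNm, ← hN] at hC
  have hN1 : 1 < N := by rw [hN]; exact Nat.one_lt_pow (by norm_num) (by omega)
  have hN0 : (0 : ℝ) < N := by exact_mod_cast (zero_lt_one.trans hN1)
  choose F hF hFE using hC
  set r : ℕ → ℝ := fun n ↦ 1 / (N : ℝ) ^ (n₀ + n) with hr
  have hr0 : ∀ n, 0 < r n := fun n ↦ by positivity
  have hrlim : Tendsto r atTop (𝓝 0) := by
    have h1 : Tendsto (fun n : ℕ ↦ ((N : ℝ)⁻¹) ^ (n + n₀)) atTop (𝓝 0) :=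
      (tendsto_add_atTop_iff_nat n₀).2 (tendsto_pow_atTop_nhds_zero_of_lt_one (by positivity)
        (inv_lt_one_of_one_lt₀ (by exact_mod_cast hN1)))
    refine h1.congr fun n ↦ ?_
    rw [inv_pow, add_comm n n₀, ← one_div]
  -- Entries of `p` have absolute value at most 2, so they are halved to fit the grid on `[-1, 1]`.
  set t : (n : ℕ) → (Fin 3 × Fin 2 → Fin (N ^ (n₀ + n))) × F n → Set X := fun n e ↦
    {x | ∃ p ∈ parab, ∃ s : ℝ × ℝ, ‖s‖ ≤ 1 ∧ x = (p * horo s * h : G) ∧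
      (∀ i (j : Fin 2), |p.1 i j.castSucc / 2 - midpt (N ^ (n₀ + n)) (e.1 (i, j))| ≤ r n) ∧
      dist s e.2 ≤ r n} with ht
  have hdiam : ∀ n e, Metric.ediam (t n e) ≤ ENNReal.ofReal (1104 * r n) := by
    intro n e
    refine Metric.ediam_le_of_forall_dist_le ?_
    rintro _ ⟨p, hp, s, hs, rfl, hpe, hse⟩ _ ⟨q, hq, s', hs', rfl, hqe, hse'⟩
    refine dist_parab_mul_horo_le hp hq (hr0 n).le (fun i j ↦ ?_) hs hs' ?_ h
    · have h1 := abs_le.1 (hpe i j)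
      have h2 := abs_le.1 (hqe i j)
      rw [abs_le]
      constructor <;> linarith [h1.1, h1.2, h2.1, h2.2]
    · have := dist_triangle_right s s' e.2
      linarith
  have hsub : ∀ n, chartAvoiding K T h ⊆ ⋃ e, t n e := by
    rintro n x ⟨p, hp, s, hs, rfl, havoid⟩
    obtain ⟨c, hc, hsc⟩ := hFE n s (mem_shortAt_of_avoid hK hm hn₀ n hp hs havoid)
    have h1 : ∀ ij : Fin 3 × Fin 2, ∃ k : Fin (N ^ (n₀ + n)),
        |p.1 ij.1 ij.2.castSucc / 2 - midpt (N ^ (n₀ + n)) k| ≤ r n := fun ij ↦ by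
      have h2 := (abs_entry_le_norm p.1 ij.1 ij.2.castSucc).trans hp.2.2.1
      obtain ⟨k, hk⟩ := exists_abs_sub_midpt_le (N := N ^ (n₀ + n)) (by positivity)
        (x := p.1 ij.1 ij.2.castSucc / 2) (by
          rw [abs_div, abs_of_pos (zero_lt_two' ℝ)]; linarith)
      refine ⟨k, hk.trans (le_of_eq ?_)⟩
      rw [hr]
      push_cast
      rfl
    choose e he using h1
    exact Set.mem_iUnion.2 ⟨(e, ⟨c, hc⟩), p, hp, s, hs, rfl, fun i j ↦ he (i, j), hsc⟩
  set B : ℝ := C * 1104 ^ d * 2 ^ n₀ / ((N : ℝ) ^ n₀) ^ 2 with hB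
  have hcount : ∀ n, (Fintype.card ((Fin 3 × Fin 2 → Fin (N ^ (n₀ + n))) × F n) : ℝ) *
      (1104 * r n) ^ d ≤ B := by
    intro n
    have e1 : (Fintype.card ((Fin 3 × Fin 2 → Fin (N ^ (n₀ + n))) × F n) : ℝ) =
        ((N : ℝ) ^ (n₀ + n)) ^ 6 * (F n).card := by
      rw [Fintype.card_prod, Fintype.card_fun, Fintype.card_prod, Fintype.card_fin,
        Fintype.card_fin, Fintype.card_fin, Fintype.card_coe]
      push_cast
      rfl
    have hP : (0 : ℝ) < (N : ℝ) ^ (n₀ + n) := by positivity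
    have e2 : (r n) ^ d = 2 ^ (n₀ + n) / ((N : ℝ) ^ (n₀ + n)) ^ 8 := by
      rw [hr, hdν]
      simp only
      rw [one_div, Real.inv_rpow hP.le, Real.rpow_sub hP, inv_div]
      congr 1
      · rw [← Real.rpow_pow_comm hN0.le, hν]
      · exact_mod_cast Real.rpow_natCast ((N : ℝ) ^ (n₀ + n)) 8
    rw [e1, Real.mul_rpow (by norm_num) (hr0 n).le, e2]
    have h1 : ((N : ℝ) ^ (n₀ + n)) ^ 6 * (F n).card *
        (1104 ^ d * (2 ^ (n₀ + n) / ((N : ℝ) ^ (n₀ + n)) ^ 8)) ≤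
        ((N : ℝ) ^ (n₀ + n)) ^ 6 * (C * ((N : ℝ) ^ 2 / 2) ^ n) *
        (1104 ^ d * (2 ^ (n₀ + n) / ((N : ℝ) ^ (n₀ + n)) ^ 8)) := by
      refine mul_le_mul_of_nonneg_right (mul_le_mul_of_nonneg_left (hF n) (by positivity)) ?_
      positivity
    refine h1.trans (le_of_eq ?_)
    rw [hB, div_pow, pow_add, pow_add]
    field_simp
    ring
  refine ne_top_of_le_ne_top ENNReal.ofReal_ne_top (b := ENNReal.ofReal B) ?_
  refine (Measure.hausdorffMeasure_le_liminf_sum d (chartAvoiding K T h) (l := atTop)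
    (fun n ↦ ENNReal.ofReal (1104 * r n)) ?_ t (Eventually.of_forall hdiam)
    (Eventually.of_forall hsub)).trans ?_
  · have := ENNReal.tendsto_ofReal (hrlim.const_mul 1104)
    rwa [mul_zero, ENNReal.ofReal_zero] at this
  · refine liminf_le_of_frequently_le' (Frequently.of_forall fun n ↦ ?_)
    have h1 : ∀ e ∈ Finset.univ, Metric.ediam (t n e) ^ d ≤
        ENNReal.ofReal ((1104 * r n) ^ d) := fun e _ ↦ by
      have h0 := hr0 n
      rw [← ENNReal.ofReal_rpow_of_nonneg (by positivity) hd]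
      exact ENNReal.rpow_le_rpow (hdiam n e) hd
    refine (Finset.sum_le_card_nsmul _ _ _ h1).trans ?_
    rw [Finset.card_univ, nsmul_eq_mul, ← ENNReal.ofReal_natCast,
      ← ENNReal.ofReal_mul (Nat.cast_nonneg _)]
    exact ENNReal.ofReal_le_ofReal (hcount n)

instance : SecondCountableTopology G :=
  Topology.IsInducing.subtypeVal.secondCountableTopology
    (β := Fin 3 → Fin 3 → ℝ)

lemma exists_countable_charts : ∃ H : Set G, H.Countable ∧ ∀ w : G, ∃ h ∈ H, ∃ p ∈ parab,
    ∃ s : ℝ × ℝ, ‖s‖ ≤ 1 ∧ w = p * horo s * h := by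
  have hnhds : ∀ h : G, {w : G | ∃ p ∈ parab, ∃ s : ℝ × ℝ, ‖s‖ ≤ 1 ∧ w = p * horo s * h} ∈ 𝓝 h := by
    intro h
    have hc : Tendsto (fun w : G ↦ w * h⁻¹) (𝓝 h) (𝓝 1) := by
      have : Continuous fun w : G ↦ w * h⁻¹ := continuous_id.mul continuous_const
      simpa using this.tendsto h
    filter_upwards [hc.eventually exists_parab_mul_horo] with w hw
    obtain ⟨p, hp, s, hs, e⟩ := hw
    exact ⟨p, hp, s, hs, by rw [← e]; group⟩
  obtain ⟨H, hH, hcover⟩ := TopologicalSpace.countable_cover_nhds hnhds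
  refine ⟨H, hH, fun w ↦ ?_⟩
  obtain ⟨h, hh, hw⟩ := Set.mem_iUnion₂.1 (hcover ▸ Set.mem_univ w)
  exact ⟨h, hh, hw⟩

end Dimension

end SL3Flow

theorem mainTheorem7 :
    ∃ K : Set SL3Flow.X, IsCompact K ∧ dimH (SL3Flow.eventuallyOutside K) < 8 := by
  obtain ⟨m, M, hm, hM1, hM⟩ := SL3Flow.exists_height_contraction
  obtain ⟨δ, hδ0, hδ⟩ := SL3Flow.exists_le_height M hM1
  -- The threshold `δ / 2` absorbs the factor 2 lost in discarding the `parab` component.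
  obtain ⟨K, hKc, hK⟩ := SL3Flow.exists_isCompact_minLen_lt (half_pos hδ0)
  obtain ⟨H, hH, hcover⟩ := SL3Flow.exists_countable_charts
  refine ⟨K, hKc, ?_⟩
  have hN : (2 : ℝ) < ((m ^ 3 : ℕ) : ℝ) := by
    have : 2 ^ 3 ≤ m ^ 3 := Nat.pow_le_pow_left hm 3
    exact_mod_cast (show 2 < 2 ^ 3 by norm_num).trans_le this
  have hlog2 : 0 < Real.log 2 := Real.log_pos one_lt_two
  have hlogN : Real.log 2 < Real.log ((m ^ 3 : ℕ) : ℝ) := Real.log_lt_log zero_lt_two hN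
  obtain ⟨ν, hν⟩ : ∃ ν, ν = Real.log 2 / Real.log ((m ^ 3 : ℕ) : ℝ) := ⟨_, rfl⟩
  have hν0 : 0 < ν := hν ▸ div_pos hlog2 (hlog2.trans hlogN)
  have hν1 : ν < 1 := hν ▸ (div_lt_one (hlog2.trans hlogN)).2 hlogN
  have hνN : ((m ^ 3 : ℕ) : ℝ) ^ ν = 2 := by
    rw [Real.rpow_def_of_pos (by linarith), hν, mul_div_cancel₀ _ (hlog2.trans hlogN).ne',
      Real.exp_log zero_lt_two]
  obtain ⟨d, hd⟩ : ∃ d : NNReal, (d : ℝ) = 8 - ν := ⟨⟨8 - ν, by linarith⟩, rfl⟩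
  have hd8 : (d : ENNReal) < 8 := by
    have h1 : (d : ℝ) < (8 : NNReal) := by rw [hd]; push_cast; linarith
    exact_mod_cast h1
  refine lt_of_le_of_lt ?_ hd8
  have hsub : SL3Flow.eventuallyOutside K ⊆
      ⋃ h ∈ H, ⋃ T : ℕ, SL3Flow.chartAvoiding K T h := by
    rintro x ⟨T, hT⟩
    obtain ⟨w, rfl⟩ := QuotientGroup.mk_surjective x
    obtain ⟨h, hh, p, hp, s, hs, rfl⟩ := hcover w
    -- Rounding `T` up to an integer keeps the union countable.
    obtain ⟨n, hn⟩ := exists_nat_ge T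
    exact Set.mem_iUnion₂.2 ⟨h, hh, Set.mem_iUnion.2
      ⟨n, p, hp, s, hs, rfl, fun t ht ↦ hT t (hn.trans_lt ht)⟩⟩
  refine (dimH_mono hsub).trans ?_
  rw [dimH_bUnion hH]
  refine iSup₂_le fun h _ ↦ ?_
  rw [dimH_iUnion]
  refine iSup_le fun T ↦ ?_
  borelize SL3Flow.X
  exact dimH_le_of_hausdorffMeasure_ne_top
    (SL3Flow.hausdorffMeasure_chartAvoiding_ne_top hK hm
      (SL3Flow.exists_isCoveredBy_shortAt (by omega) hM1 hM hδ) d.2 hd hνN T h)
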